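/- Let $\alpha,\mu>-1$ and $\zeta<1$ be real, and for $t>0$ consider on $(0,\infty)$ the deformed Laguerre weight $$w_t(x)=(1-\zeta\,\theta(x-t))\,(x-t)^{\alpha}x^{\mu}e^{-x},$$ where $\theta(y)=1$ for $y>0$ and $\theta(y)=0$ otherwise, and where for $x<t$ the power $(x-t)^\alpha$ means $\omega\,|x-t|^\alpha$ with a fixed constant $\omega\in\mathbb C$ (so $\omega=(-1)^\alpha$ for integer $\alpha$, and $\omega=1$ gives $|x-t|^\alpha$). Put $\langle f,g\rangle_t=\int_0^\infty f(x)g(x)w_t(x)\,dx$. Fix $n\ge 1$ and $t>0$, and suppose that for all $s$ near $t$ the polynomials $p_k(x)=p_k(x;s)=\gamma_kx^k+\gamma_{k,1}x^{k-1}+\cdots$, $0\le k\le n+1$, of degree exactly $k$ (with $\gamma_{0,1}=0$), satisfy $\langle p_i,p_j\rangle_s=\delta_{ij}$. (For a positive weight such polynomials always exist.) The signs of the $p_k$, $k\le n$, which orthonormality leaves free, are chosen consistently near $t$: $\operatorname{Re}(\gamma_k(s)/\gamma_k(t))>0$ for $s$ near $t$, as holds for instance if all $\gamma_k>0$. At the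 parameter $t$ put $$a_k=\frac{\gamma_{k-1}}{\gamma_k},\qquad b_k=\frac{\gamma_{k,1}}{\gamma_k}-\frac{\gamma_{k+1,1}}{\gamma_{k+1}},\qquad \theta_k=b_k-2k-1-\alpha-\mu-t,\qquad \kappa_n=\Big(n+\frac{\mu}{2}\Big)t+a_n^2+\frac{\gamma_{n,1}}{\gamma_n},$$ $$A_\infty=\begin{pmatrix}0&0\\0&1\end{pmatrix},\qquad A_0=\frac1t\begin{pmatrix}\kappa_n-\frac{\mu t}{2}&-a_n\theta_n\\ a_n\theta_{n-1}&-\kappa_n-\frac{\mu t}{2}\end{pmatrix},\qquad A_t=\frac1t\begin{pmatrix}(n+\frac{\mu}{2})t-\kappa_n&a_n(\theta_n+t)\\-a_n(\theta_{n-1}+t)&\kappa_n-(n+\alpha+\frac{\mu}{2})t\end{pmatrix},$$ $$B=\frac1{2t}\begin{pmatrix}\theta_n+t&0\\0&-\theta_{n-1}-t\end{pmatrix}.$$ Then $a_k,b_k$ are the coefficients of the three term recurrence, $a_{k+1}p_{k+1}=(x-b_k)p_k-a_kp_{k-1}$ for $0\le k\le n$ (with $a_0p_{-1}:=0$), and,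 besides $$\partial_x\begin{pmatrix}p_n\\p_{n-1}\end{pmatrix}=\Big(A_\infty+\frac{A_0}{x}+\frac{A_t}{x-t}\Big)\begin{pmatrix}p_n\\p_{n-1}\end{pmatrix}\qquad(x\in\mathbb C,\ x\ne0,t),$$ the vector $(p_n,p_{n-1})$ also is differentiable in the parameter at $t$ and satisfies $$\partial_t\begin{pmatrix}p_n\\p_{n-1}\end{pmatrix}=\Big(B-\frac{A_t}{x-t}\Big)\begin{pmatrix}p_n\\p_{n-1}\end{pmatrix}\qquad(x\in\mathbb C,\ x\ne t).$$ Moreover $\gamma_n$ and $\gamma_{n-1}$ are differentiable in the parameter at $t$, with $$\frac{2\,\partial_t\gamma_n}{\gamma_n}=1+\frac{\theta_n}{t},\qquad \frac{2\,\partial_t\gamma_{n-1}}{\gamma_{n-1}}=1+\frac{\theta_{n-1}}{t},$$ so that $B=\operatorname{diag}\big(\partial_t\gamma_n/\gamma_n,\,-\partial_t\gamma_{n-1}/\gamma_{n-1}\big)$. -/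

import Mathlib

open Polynomial Matrix Filter Topology

noncomputable section

/-- The power `u ^ α` of a real number `u`, with a fixed constant `ω` in the role of `(-1) ^ α`
on the negative axis. For `α = m` a natural number and `ω = (-1) ^ m` this is the ordinary power
`u ^ m`; for `ω = 1` it is `|u| ^ α`; for `ω = exp (± π i α)` it is a branch of the complex
power. -/
def branchPow (ω : ℂ) (α u : ℝ) : ℂ :=
  if u < 0 then ω * (((-u) ^ α : ℝ) : ℂ) else ((u ^ α : ℝ) : ℂ)

/-- The deformed Laguerre weight
`w(x) = (1 - ζ θ(x - t)) (x - t) ^ α x ^ μ e ^ (-x)` on the positive half line, with `θ` the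
Heaviside function. -/
def deformedLaguerreWeight (ζ α μ : ℝ) (ω : ℂ) (t x : ℝ) : ℂ :=
  (1 - (ζ : ℂ) * (if 0 < x - t then 1 else 0)) * branchPow ω α (x - t) *
    ((x ^ μ : ℝ) : ℂ) * ((Real.exp (-x) : ℝ) : ℂ)

/-- The (symmetric, complex bilinear) form `⟨f, g⟩ = ∫_0^∞ f(x) g(x) w(x) dx`. -/
def weightForm (w : ℝ → ℂ) (f g : ℂ[X]) : ℂ :=
  ∫ x in Set.Ioi (0 : ℝ), f.eval (x : ℂ) * g.eval (x : ℂ) * w x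

/-- `p 0, …, p N` are the first `N + 1` orthonormal polynomials for the weight `w`: `p k` has
degree exactly `k`, and `⟨p i, p j⟩ = δ_{ij}`. -/
structure IsOrthonormalUpTo (N : ℕ) (w : ℝ → ℂ) (p : ℕ → ℂ[X]) : Prop where
  degree_eq : ∀ k ≤ N, (p k).degree = (k : WithBot ℕ)
  orthonormal : ∀ i ≤ N, ∀ j ≤ N, weightForm w (p i) (p j) = if i = j then 1 else 0

namespace OrthoPoly

/-- The coefficient `γ_n` of `x ^ n` in `p_n(x) = γ_n x ^ n + γ_{n,1} x ^ (n - 1) + ⋯`. -/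
def gam (p : ℕ → ℂ[X]) (n : ℕ) : ℂ := (p n).leadingCoeff

/-- The coefficient `γ_{n,1}` of `x ^ (n - 1)` in `p_n`, with `γ_{0,1} = 0`. -/
def gam1 (p : ℕ → ℂ[X]) (n : ℕ) : ℂ := (p n).nextCoeff

/-- The coefficient `a_n` of the three term recurrence
`a_{n+1} p_{n+1} = (x - b_n) p_n - a_n p_{n-1}`, `n ≥ 1`. -/
def aCoeff (p : ℕ → ℂ[X]) (n : ℕ) : ℂ := gam p (n - 1) / gam p n

/-- The coefficient `b_n` of the three term recurrence. -/
def bCoeff (p : ℕ → ℂ[X]) (n : ℕ) : ℂ := gam1 p n / gam p n - gam1 p (n + 1) / gam p (n + 1)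

/-- `θ_n = b_n - 2 n - 1 - α - μ - t`. -/
def theta (α μ t : ℝ) (p : ℕ → ℂ[X]) (n : ℕ) : ℂ := bCoeff p n - 2 * n - 1 - α - μ - t

/-- `κ_n = (n + μ / 2) t + a_n ^ 2 + γ_{n,1} / γ_n`. -/
def kappa (μ t : ℝ) (p : ℕ → ℂ[X]) (n : ℕ) : ℂ :=
  (n + μ / 2) * t + aCoeff p n ^ 2 + gam1 p n / gam p n

/-- The residue matrix at `x = 0` of the linear system in `x`. -/
def matA0 (α μ t : ℝ) (p : ℕ → ℂ[X]) (n : ℕ) : Matrix (Fin 2) (Fin 2) ℂ :=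
  (1 / (t : ℂ)) •
    !![kappa μ t p n - μ * t / 2, -(aCoeff p n * theta α μ t p n);
       aCoeff p n * theta α μ t p (n - 1), -kappa μ t p n - μ * t / 2]

/-- The residue matrix at `x = t` of the linear system in `x`. -/
def matAt (α μ t : ℝ) (p : ℕ → ℂ[X]) (n : ℕ) : Matrix (Fin 2) (Fin 2) ℂ :=
  (1 / (t : ℂ)) •
    !![(n + μ / 2) * t - kappa μ t p n, aCoeff p n * (theta α μ t p n + t);
       -(aCoeff p n * (theta α μ t p (n - 1) + t)), kappa μ t p n - (n + α + μ / 2) * t]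

/-- The constant term at `x = ∞` of the linear system in `x`. -/
def matAInf : Matrix (Fin 2) (Fin 2) ℂ := !![0, 0; 0, 1]

/-- `B = (1 / 2t) diag(θ_n + t, -θ_{n-1} - t)`. -/
def matB (α μ t : ℝ) (p : ℕ → ℂ[X]) (n : ℕ) : Matrix (Fin 2) (Fin 2) ℂ :=
  (1 / (2 * (t : ℂ))) • !![theta α μ t p n + t, 0; 0, -theta α μ t p (n - 1) - t]

/-- The column vector `(p_n(x), p_{n-1}(x))`. -/
def vec (p : ℕ → ℂ[X]) (n : ℕ) (x : ℂ) : Fin 2 → ℂ := ![(p n).eval x, (p (n - 1)).eval x]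

end OrthoPoly

end

/-! Two analytic facts about the functional L_t(f) = ∫ f w_t carry everything. First, x(x - t)w_t f
vanishes at 0, t and ∞ because α, μ > -1, so the integral of its derivative is zero over (0, t) and
over (t, ∞) separately. The resulting identity `IsPearson` therefore contains neither ω nor ζ.
Second, after x = ty the singular point is fixed at y = 1 and t occurs only in a power and in
e^(-ty). Hence t ∂_t L_t f = L_t((α + μ + 1)f + x f' - x f) (`hasDerivAt_laguerreFunctional`), even
for α < 0, where ∂_t w_t is not integrable.

The rest is algebra with a symmetric bilinear form that need not be positive. L(p_k f) depends only
on the top coefficients of f when deg f ≤ k + 1, and a polynomial of degree ≤ k that pairs to zero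
with all polynomials of degree ≤ k vanishes (`eq_zero_of_forall_functional_mul`). The recurrence,
the two rows of the x-system (`ladder_upper`, `ladder_lower`, from Pearson) and
`deformation_equation` are all proved this way, the last by differentiating L_s(p_k f) = f_k /
γ_k(s) for fixed f. It expresses t ∂_t p_k through x ∂_x p_k and neighbouring polynomials;
eliminating x ∂_x p_k by the ladder relations gives the t-system.

Differentiability in the parameter comes from Gram–Schmidt (`exists_hasPolyDerivAt`); it determines
γ_k only up to sign, and the sign condition selects the root. -/

namespace OrthoPoly

/-! ### Orthonormal polynomials of a moment functional -/

/-- `p 0, …, p N` have exact degrees and are orthonormal for the moment functional `L`. -/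
structure IsOrthonormalFor (L : ℂ[X] →ₗ[ℂ] ℂ) (N : ℕ) (p : ℕ → ℂ[X]) : Prop where
  degree_eq : ∀ k ≤ N, (p k).degree = (k : WithBot ℕ)
  orthonormal : ∀ i ≤ N, ∀ j ≤ N, L (p i * p j) = if i = j then 1 else 0

/-- The Pearson equation of the weight `(x - t) ^ α x ^ μ e ^ (-x)`. -/
def IsPearson (α μ t : ℝ) (L : ℂ[X] →ₗ[ℂ] ℂ) : Prop :=
  ∀ f : ℂ[X], L (X * (X - C (t : ℂ)) * derivative f +
    (C (α + 1 : ℂ) * X + C (μ + 1 : ℂ) * (X - C (t : ℂ)) - X * (X - C (t : ℂ))) * f) = 0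

theorem coeff_X_mul_derivative (f : ℂ[X]) (i : ℕ) :
    (X * derivative f).coeff i = i * f.coeff i := by
  cases i with
  | zero => simp
  | succ i => rw [coeff_X_mul, coeff_derivative]; push_cast; ring

/-- Written with `X * f` instead of a coefficient at i - 1, so that i = 0 needs no exception: both
sides vanish there. -/
theorem coeff_X_mul_X_mul_derivative (f : ℂ[X]) (i : ℕ) :
    (X * (X * derivative f)).coeff i = ((i : ℂ) - 1) * (X * f).coeff i := by
  cases i with
  | zero => simp
  | succ i => rw [coeff_X_mul, coeff_X_mul_derivative, coeff_X_mul]; push_cast; ring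

namespace IsOrthonormalFor

variable {L : ℂ[X] →ₗ[ℂ] ℂ} {N : ℕ} {p : ℕ → ℂ[X]}

theorem natDegree_eq (h : IsOrthonormalFor L N p) {k : ℕ} (hk : k ≤ N) : (p k).natDegree = k :=
  natDegree_eq_of_degree_eq_some (h.degree_eq k hk)

theorem coeff_self (h : IsOrthonormalFor L N p) {k : ℕ} (hk : k ≤ N) :
    (p k).coeff k = gam p k := by
  rw [gam, leadingCoeff, h.natDegree_eq hk]

theorem coeff_of_lt (h : IsOrthonormalFor L N p) {k i : ℕ} (hk : k ≤ N) (hi : k < i) :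
    (p k).coeff i = 0 :=
  coeff_eq_zero_of_natDegree_lt (by rwa [h.natDegree_eq hk])

theorem gam_ne_zero (h : IsOrthonormalFor L N p) {k : ℕ} (hk : k ≤ N) : gam p k ≠ 0 := by
  rw [gam, Ne, leadingCoeff_eq_zero]
  intro h0
  simpa [h0] using h.degree_eq k hk

/-- The factor X shifts the index and so covers k = 0, where it yields the convention γ_{0,1} = 0.
-/
theorem coeff_X_mul_self (h : IsOrthonormalFor L N p) {k : ℕ} (hk : k ≤ N) :
    (X * p k).coeff k = gam1 p k := by
  rw [gam1, nextCoeff, h.natDegree_eq hk]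
  cases k with
  | zero => simp
  | succ k => simp

theorem coeff_pred (h : IsOrthonormalFor L N p) {k : ℕ} (hk : k + 1 ≤ N) :
    (p (k + 1)).coeff k = gam1 p (k + 1) := by
  rw [← h.coeff_X_mul_self hk, coeff_X_mul]

/-- Induction on the degree bound d: removing the right multiple of p_d lowers the bound, and p_d
itself is orthogonal to p_k. -/
theorem functional_mul_eq_zero (h : IsOrthonormalFor L N p) {k : ℕ} (hk : k ≤ N) (d : ℕ) :
    d ≤ k → ∀ f : ℂ[X], (∀ i, d ≤ i → f.coeff i = 0) → L (p k * f) = 0 := by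
  induction d with
  | zero =>
    intro _ f hf
    have : f = 0 := by ext i; simpa using hf i (Nat.zero_le i)
    simp [this]
  | succ d ih =>
    intro hd f hf
    have hg := h.gam_ne_zero (show d ≤ N by omega)
    have h1 := ih (by omega) (f - C (f.coeff d / gam p d) * p d) (by
      intro i hi
      rw [coeff_sub, coeff_C_mul]
      rcases hi.eq_or_lt with rfl | hi
      · rw [h.coeff_self (by omega)]; field_simp; ring
      · rw [hf i hi, h.coeff_of_lt (by omega) hi]; ring)
    have h2 : p k * (f - C (f.coeff d / gam p d) * p d) =
        p k * f - (f.coeff d / gam p d) • (p k * p d) := by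
      rw [smul_eq_C_mul]; ring
    rw [h2, map_sub, map_smul, h.orthonormal k hk d (by omega), if_neg (by omega)] at h1
    simpa using h1

theorem functional_mul_of_natDegree_le (h : IsOrthonormalFor L N p) {k : ℕ} (hk : k ≤ N)
    (f : ℂ[X]) (hf : ∀ i, k < i → f.coeff i = 0) : L (p k * f) = f.coeff k / gam p k := by
  have hg := h.gam_ne_zero hk
  have h1 := h.functional_mul_eq_zero hk k le_rfl (f - C (f.coeff k / gam p k) * p k) (by
      intro i hi
      rw [coeff_sub, coeff_C_mul]
      rcases hi.eq_or_lt with rfl | hi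
      · rw [h.coeff_self hk]; field_simp; ring
      · rw [hf i hi, h.coeff_of_lt hk hi]; ring)
  have h2 : p k * (f - C (f.coeff k / gam p k) * p k) =
      p k * f - (f.coeff k / gam p k) • (p k * p k) := by
    rw [smul_eq_C_mul]; ring
  rw [h2, map_sub, map_smul, h.orthonormal k hk k hk, if_pos rfl] at h1
  simpa [sub_eq_zero] using h1

/-- Subtracting a multiple of p_{k+1} brings the degree down to k without changing the pairing with
p_k. The second coefficient of p_{k+1} enters here, and this is the source of b_k in all later
formulas. -/
theorem functional_mul_of_natDegree_le_succ (h : IsOrthonormalFor L N p) {k : ℕ}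
    (hk : k + 1 ≤ N) (f : ℂ[X]) (hf : ∀ i, k + 1 < i → f.coeff i = 0) :
    L (p k * f) =
      (f.coeff k - f.coeff (k + 1) * (gam1 p (k + 1) / gam p (k + 1))) / gam p k := by
  have hg := h.gam_ne_zero hk
  have h1 := h.functional_mul_of_natDegree_le (show k ≤ N by omega)
    (f - C (f.coeff (k + 1) / gam p (k + 1)) * p (k + 1)) (by
      intro i hi
      rw [coeff_sub, coeff_C_mul]
      rcases Nat.eq_or_lt_of_le (show k + 1 ≤ i from hi) with rfl | hi
      · rw [h.coeff_self hk]; field_simp; ring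
      · rw [hf i hi, h.coeff_of_lt hk hi]; ring)
  have h2 : p k * (f - C (f.coeff (k + 1) / gam p (k + 1)) * p (k + 1)) =
      p k * f - (f.coeff (k + 1) / gam p (k + 1)) • (p k * p (k + 1)) := by
    rw [smul_eq_C_mul]; ring
  rw [h2, map_sub, map_smul, h.orthonormal k (by omega) (k + 1) hk, if_neg (by omega), coeff_sub,
    coeff_C_mul, h.coeff_pred hk] at h1
  simp only [smul_zero, sub_zero] at h1
  rw [h1]; ring

/-- Nondegeneracy without positivity: a nonzero Q of degree d pairs with p_d to its leading
coefficient divided by γ_d, which is not zero. -/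
theorem eq_zero_of_forall_functional_mul (h : IsOrthonormalFor L N p) {k : ℕ} (hk : k ≤ N)
    (Q : ℂ[X]) (hQ : ∀ i, k < i → Q.coeff i = 0)
    (hL : ∀ f : ℂ[X], (∀ i, k < i → f.coeff i = 0) → L (Q * f) = 0) : Q = 0 := by
  by_contra hne
  have hd : Q.natDegree ≤ k := by
    by_contra hlt
    exact hne (leadingCoeff_eq_zero.1 (hQ _ (not_le.1 hlt)))
  have h1 := hL (p Q.natDegree) fun i hi => h.coeff_of_lt (hd.trans hk) (hd.trans_lt hi)
  rw [mul_comm, h.functional_mul_of_natDegree_le (hd.trans hk) Q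
    fun i hi => coeff_eq_zero_of_natDegree_lt hi] at h1
  rcases div_eq_zero_iff.1 h1 with h2 | h2
  · exact hne (leadingCoeff_eq_zero.1 h2)
  · exact h.gam_ne_zero (hd.trans hk) h2

theorem three_term_recurrence_zero (h : IsOrthonormalFor L N p) (hN : 1 ≤ N) :
    C (aCoeff p 1) * p 1 = (X - C (bCoeff p 0)) * p 0 := by
  have g1 := h.gam_ne_zero hN
  have g0 := h.gam_ne_zero (Nat.zero_le N)
  have e : gam1 p 0 = 0 := by rw [← h.coeff_X_mul_self (Nat.zero_le N)]; simp
  rw [sub_mul]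
  ext i
  rw [coeff_sub, coeff_C_mul, coeff_C_mul]
  rcases i with _ | _ | i
  · rw [h.coeff_pred hN, h.coeff_X_mul_self (Nat.zero_le N), h.coeff_self (Nat.zero_le N)]
    simp only [aCoeff, bCoeff, e]
    field_simp; ring_nf
  · rw [coeff_X_mul]
    simp only [zero_add]
    rw [h.coeff_self hN, h.coeff_self (Nat.zero_le N),
      h.coeff_of_lt (Nat.zero_le N) Nat.zero_lt_one]
    simp only [aCoeff, tsub_self]
    field_simp; ring
  · rw [coeff_X_mul, h.coeff_of_lt hN (by omega), h.coeff_of_lt (Nat.zero_le N) (by omega),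
      h.coeff_of_lt (Nat.zero_le N) (by omega)]
    ring

theorem three_term_recurrence_succ (h : IsOrthonormalFor L N p) {k : ℕ} (hk : k + 2 ≤ N) :
    C (aCoeff p (k + 2)) * p (k + 2) =
      (X - C (bCoeff p (k + 1))) * p (k + 1) - C (aCoeff p (k + 1)) * p k := by
  have g2 := h.gam_ne_zero hk
  have g1 := h.gam_ne_zero (show k + 1 ≤ N by omega)
  have g0 := h.gam_ne_zero (show k ≤ N by omega)
  have c2 := h.coeff_self hk
  have c2' := h.coeff_pred (show (k + 1) + 1 ≤ N from hk)
  have c1 := h.coeff_self (show k + 1 ≤ N by omega)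
  have c1' := h.coeff_pred (show k + 1 ≤ N by omega)
  have ha : aCoeff p (k + 2) = gam p (k + 1) / gam p (k + 2) := rfl
  have ha' : aCoeff p (k + 1) = gam p k / gam p (k + 1) := rfl
  have hb : bCoeff p (k + 1) =
    gam1 p (k + 1) / gam p (k + 1) - gam1 p (k + 2) / gam p (k + 2) := rfl
  rw [← sub_eq_zero]
  -- The values of a_{k+2} and b_{k+1} cancel the coefficients of X^(k+2) and X^(k+1). On testing
  -- with f, only p_{k+1} · X f and p_k · f contribute, and they balance through a_{k+1}.
  refine h.eq_zero_of_forall_functional_mul (show k ≤ N by omega) _ ?_ ?_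
  · intro i hi
    obtain ⟨i, rfl⟩ : ∃ j, i = j + 1 := ⟨i - 1, by omega⟩
    simp only [sub_mul, coeff_sub, coeff_C_mul, coeff_X_mul]
    rw [h.coeff_of_lt (show k ≤ N by omega) hi]
    rcases Nat.eq_or_lt_of_le (show k ≤ i by omega) with rfl | hi
    · rw [c2', c1, c1', ha, hb]
      field_simp; ring
    rw [h.coeff_of_lt (show k + 1 ≤ N by omega) (show k + 1 < i + 1 by omega)]
    rcases Nat.eq_or_lt_of_le (show k + 1 ≤ i by omega) with rfl | hi
    · rw [c2, c1, ha]
      field_simp; ring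
    rw [h.coeff_of_lt hk (by omega), h.coeff_of_lt (show k + 1 ≤ N by omega) (by omega)]
    ring
  · intro f hf
    have e : (C (aCoeff p (k + 2)) * p (k + 2) -
        ((X - C (bCoeff p (k + 1))) * p (k + 1) - C (aCoeff p (k + 1)) * p k)) * f =
        aCoeff p (k + 2) • (p (k + 2) * f) - p (k + 1) * (X * f) +
        bCoeff p (k + 1) • (p (k + 1) * f) + aCoeff p (k + 1) • (p k * f) := by
      simp only [smul_eq_C_mul]; ring
    rw [e, map_add, map_add, map_sub, map_smul, map_smul, map_smul,
      h.functional_mul_of_natDegree_le hk f fun i hi => hf i (by omega),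
      h.functional_mul_of_natDegree_le (show k + 1 ≤ N by omega) f fun i hi => hf i (by omega),
      h.functional_mul_of_natDegree_le (show k ≤ N by omega) f hf,
      h.functional_mul_of_natDegree_le (show k + 1 ≤ N by omega) (X * f) (by
        intro i hi
        obtain ⟨i, rfl⟩ : ∃ j, i = j + 1 := ⟨i - 1, by omega⟩
        rw [coeff_X_mul, hf i (by omega)]),
      coeff_X_mul, hf (k + 2) (by omega), hf (k + 1) (by omega), ha']
    simp only [smul_eq_mul]
    field_simp; ring

theorem three_term_recurrence (h : IsOrthonormalFor L N p) {k : ℕ} (hk : k + 1 ≤ N) :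
    C (aCoeff p (k + 1)) * p (k + 1) =
      (X - C (bCoeff p k)) * p k - (if k = 0 then 0 else C (aCoeff p k) * p (k - 1)) := by
  rcases k with _ | k
  · simpa using h.three_term_recurrence_zero hk
  · simpa using h.three_term_recurrence_succ hk

/-! ### Ladder relations from the Pearson equation -/

/-- The first row of the linear system in `x`, multiplied by `x (x - t)`. -/
theorem ladder_upper (h : IsOrthonormalFor L N p) {α μ t : ℝ} (hP : IsPearson α μ t L) {m : ℕ}
    (hm : m + 2 ≤ N) :
    X * (X - C (t : ℂ)) * derivative (p (m + 1)) =
      (C ((m : ℂ) + 1) * X - C (kappa μ t p (m + 1) - μ * t / 2)) * p (m + 1) +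
        C (aCoeff p (m + 1)) * (X + C (theta α μ t p (m + 1))) * p m := by
  have g2 := h.gam_ne_zero hm
  have g1 := h.gam_ne_zero (show m + 1 ≤ N by omega)
  have g0 := h.gam_ne_zero (show m ≤ N by omega)
  have c1 := h.coeff_self (show m + 1 ≤ N by omega)
  have c1' := h.coeff_pred (show m + 1 ≤ N by omega)
  have c0 := h.coeff_self (show m ≤ N by omega)
  have ha : aCoeff p (m + 1) = gam p m / gam p (m + 1) := rfl
  have hb : theta α μ t p (m + 1) =
    gam1 p (m + 1) / gam p (m + 1) - gam1 p (m + 2) / gam p (m + 2) - 2 * (m + 1 : ℂ) - 1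
      - α - μ - t := by
    simp [theta, bCoeff]
  have hκ : kappa μ t p (m + 1) = (m + 1 + μ / 2) * t + (gam p m / gam p (m + 1)) ^ 2 +
    gam1 p (m + 1) / gam p (m + 1) := by
    simp [kappa, ha]
  set c := kappa μ t p (m + 1) - μ * t / 2 with hc
  set θ := theta α μ t p (m + 1)
  set a := aCoeff p (m + 1)
  rw [← sub_eq_zero]
  have norm : X * (X - C (t : ℂ)) * derivative (p (m + 1)) -
      ((C ((m : ℂ) + 1) * X - C c) * p (m + 1) + C a * (X + C θ) * p m) =
      X * (X * derivative (p (m + 1))) - C (t : ℂ) * (X * derivative (p (m + 1))) -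
      (C ((m : ℂ) + 1) * (X * p (m + 1)) - C c * p (m + 1) + C a * (X * p m) +
        C a * (C θ * p m)) := by ring
  -- The value of κ is what brings the degree down to m; the value of θ is what the testing
  -- requires.
  refine h.eq_zero_of_forall_functional_mul (show m ≤ N by omega) _ ?_ ?_
  · intro i hi
    obtain ⟨i, rfl⟩ : ∃ j, i = j + 1 := ⟨i - 1, by omega⟩
    rw [norm]
    simp only [coeff_sub, coeff_add, coeff_C_mul, coeff_X_mul_derivative,
      coeff_X_mul_X_mul_derivative]
    simp only [coeff_X_mul]
    rw [h.coeff_of_lt (show m ≤ N by omega) hi]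
    rcases Nat.eq_or_lt_of_le (show m ≤ i by omega) with rfl | hi
    · rw [c1, c1', c0, hc, hκ, ha]
      push_cast
      field_simp; ring
    rw [h.coeff_of_lt (show m + 1 ≤ N by omega) (show m + 1 < i + 1 by omega),
      h.coeff_of_lt (show m ≤ N by omega) (show m < i by omega)]
    rcases Nat.eq_or_lt_of_le (show m + 1 ≤ i by omega) with rfl | hi
    · push_cast; ring
    rw [h.coeff_of_lt (show m + 1 ≤ N by omega) (by omega)]
    ring
  · intro f hf
    -- The Leibniz rule moves the derivative from p_{m+1} to f, at the price of a bracket that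
    -- Pearson annihilates.
    have e : (X * (X - C (t : ℂ)) * derivative (p (m + 1)) -
      ((C ((m : ℂ) + 1) * X - C c) * p (m + 1) + C a * (X + C θ) * p m)) * f =
      (X * (X - C (t : ℂ)) * derivative (p (m + 1) * f) +
      (C (α + 1 : ℂ) * X + C (μ + 1 : ℂ) * (X - C (t : ℂ)) - X * (X - C (t : ℂ))) *
        (p (m + 1) * f)) -
      p (m + 1) * (X * (X * derivative f) - C (t : ℂ) * (X * derivative f) +
        C (α + μ + 2 + t + (m + 1) : ℂ) * (X * f) - C ((μ + 1) * t + c : ℂ) * f -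
          X * (X * f)) -
      a • (p m * (X * f + C θ * f)) := by
      simp only [smul_eq_C_mul, derivative_mul, map_add, map_mul, map_one, C_ofNat]; ring
    have hX : ∀ i, m + 1 < i → (X * f).coeff i = 0 := by
      intro i hi
      obtain ⟨i, rfl⟩ : ∃ j, i = j + 1 := ⟨i - 1, by omega⟩
      rw [coeff_X_mul, hf i (by omega)]
    rw [e, map_sub, map_sub, map_smul, hP,
      h.functional_mul_of_natDegree_le_succ (show m + 1 + 1 ≤ N from hm),
      h.functional_mul_of_natDegree_le_succ (show m + 1 ≤ N by omega)]
    · simp only [coeff_sub, coeff_add, coeff_C_mul, coeff_X_mul_derivative,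
        coeff_X_mul_X_mul_derivative]
      simp only [coeff_X_mul]
      rw [hf (m + 1) (by omega), hf (m + 1 + 1) (by omega), hb, ha]
      simp only [smul_eq_mul]
      push_cast
      field_simp; ring
    · intro i hi
      rw [coeff_add, coeff_C_mul, hX i hi, hf i (by omega)]; ring
    · intro i hi
      obtain ⟨i, rfl⟩ : ∃ j, i = j + 1 := ⟨i - 1, by omega⟩
      simp only [coeff_sub, coeff_add, coeff_C_mul, coeff_X_mul_derivative,
        coeff_X_mul_X_mul_derivative]
      rw [coeff_X_mul, coeff_X_mul, hX i (by omega), hf i (by omega), hf (i + 1) (by omega)]; ring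

/-- The second row of the linear system in `x`, multiplied by `x (x - t)`. -/
theorem ladder_lower (h : IsOrthonormalFor L N p) {α μ t : ℝ} (hP : IsPearson α μ t L) {m : ℕ}
    (hm : m + 1 ≤ N) :
    X * (X - C (t : ℂ)) * derivative (p m) =
      (X * (X - C (t : ℂ)) - C (μ + (m + 1) + α : ℂ) * X +
        C (kappa μ t p (m + 1) + μ * t / 2)) * p m -
        C (aCoeff p (m + 1)) * (X + C (theta α μ t p m)) * p (m + 1) := by
  have g1 := h.gam_ne_zero hm
  have g0 := h.gam_ne_zero (show m ≤ N by omega)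
  have c1 := h.coeff_self hm
  have c1' := h.coeff_pred hm
  have c0 := h.coeff_self (show m ≤ N by omega)
  have c0' := h.coeff_X_mul_self (show m ≤ N by omega)
  have ha : aCoeff p (m + 1) = gam p m / gam p (m + 1) := rfl
  have hb : theta α μ t p m =
    gam1 p m / gam p m - gam1 p (m + 1) / gam p (m + 1) - 2 * (m : ℂ) - 1
      - α - μ - t := by
    simp [theta, bCoeff]
  have hκ : kappa μ t p (m + 1) = (m + 1 + μ / 2) * t + (gam p m / gam p (m + 1)) ^ 2 +
    gam1 p (m + 1) / gam p (m + 1) := by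
    simp [kappa, ha]
  set c := kappa μ t p (m + 1) + μ * t / 2 with hc
  set θ := theta α μ t p m
  set a := aCoeff p (m + 1)
  rw [← sub_eq_zero]
  have norm : X * (X - C (t : ℂ)) * derivative (p m) -
      ((X * (X - C (t : ℂ)) - C (μ + (m + 1) + α : ℂ) * X + C c) * p m -
        C a * (X + C θ) * p (m + 1)) =
      X * (X * derivative (p m)) - C (t : ℂ) * (X * derivative (p m)) -
      (X * (X * p m) - C (t : ℂ) * (X * p m) - C (μ + (m + 1) + α : ℂ) * (X * p m) + C c * p m
        - C a * (X * p (m + 1)) - C a * (C θ * p (m + 1))) := by ring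
  -- The roles are exchanged compared with the first row: θ brings the degree down to m, and κ is
  -- needed for the testing.
  refine h.eq_zero_of_forall_functional_mul (show m ≤ N by omega) _ ?_ ?_
  · intro i hi
    obtain ⟨i, rfl⟩ : ∃ j, i = j + 1 := ⟨i - 1, by omega⟩
    rw [norm]
    simp only [coeff_sub, coeff_add, coeff_C_mul, coeff_X_mul_derivative,
      coeff_X_mul_X_mul_derivative]
    simp only [coeff_X_mul]
    rw [h.coeff_of_lt (show m ≤ N by omega) hi]
    rcases Nat.eq_or_lt_of_le (show m ≤ i by omega) with rfl | hi
    · rw [c1, c1', c0, c0', hb, ha]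
      push_cast
      field_simp; ring
    rw [h.coeff_of_lt hm (show m + 1 < i + 1 by omega),
      h.coeff_of_lt (show m ≤ N by omega) (show m < i by omega)]
    obtain ⟨i, rfl⟩ : ∃ j, i = j + 1 := ⟨i - 1, by omega⟩
    rw [coeff_X_mul]
    rcases Nat.eq_or_lt_of_le (show m ≤ i by omega) with rfl | hi
    · rw [c0, c1, ha]
      field_simp; ring
    rw [h.coeff_of_lt (show m ≤ N by omega) (by omega), h.coeff_of_lt hm (by omega)]
    ring
  · intro f hf
    -- The term X(X - t) p_m f cancels against the one in the Pearson bracket, so p_m is paired with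
    -- degree m + 1 only and p_{m+2} is not needed.
    have e : (X * (X - C (t : ℂ)) * derivative (p m) -
      ((X * (X - C (t : ℂ)) - C (μ + (m + 1) + α : ℂ) * X + C c) * p m -
        C a * (X + C θ) * p (m + 1))) * f =
      (X * (X - C (t : ℂ)) * derivative (p m * f) +
      (C (α + 1 : ℂ) * X + C (μ + 1 : ℂ) * (X - C (t : ℂ)) - X * (X - C (t : ℂ))) *
        (p m * f)) -
      p m * (X * (X * derivative f) - C (t : ℂ) * (X * derivative f) +
        C (α + μ + 2 - (μ + (m + 1) + α) : ℂ) * (X * f) - C ((μ + 1) * t - c : ℂ) * f) +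
      a • (p (m + 1) * (X * f + C θ * f)) := by
      simp only [smul_eq_C_mul, derivative_mul, map_add, map_sub, map_mul, map_one, C_ofNat]; ring
    have hX : ∀ i, m + 1 < i → (X * f).coeff i = 0 := by
      intro i hi
      obtain ⟨i, rfl⟩ : ∃ j, i = j + 1 := ⟨i - 1, by omega⟩
      rw [coeff_X_mul, hf i (by omega)]
    rw [e, map_add, map_sub, map_smul, hP,
      h.functional_mul_of_natDegree_le_succ hm,
      h.functional_mul_of_natDegree_le hm]
    · simp only [coeff_sub, coeff_add, coeff_C_mul, coeff_X_mul_derivative,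
        coeff_X_mul_X_mul_derivative]
      simp only [coeff_X_mul]
      rw [hf (m + 1) (by omega), hc, hκ, ha]
      simp only [smul_eq_mul]
      push_cast
      field_simp; ring
    · intro i hi
      rw [coeff_add, coeff_C_mul, hX i hi, hf i (by omega)]; ring
    · intro i hi
      simp only [coeff_sub, coeff_add, coeff_C_mul, coeff_X_mul_derivative,
        coeff_X_mul_X_mul_derivative]
      rw [hX i (by omega), hf i (by omega)]; ring

end IsOrthonormalFor
end OrthoPoly

/-! ### Moments with the singular point at 1: integrability, derivative, integration by parts -/

namespace OrthoPoly
open MeasureTheory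

/-- The integrand `|y - 1| ^ α y ^ ν e ^ (-c y)`. -/
noncomputable def momentIntegrand (α ν c y : ℝ) : ℝ :=
  |y - 1| ^ α * y ^ ν * Real.exp (-(c * y))

theorem measurable_momentIntegrand (α ν c : ℝ) : Measurable (momentIntegrand α ν c) := by
  unfold momentIntegrand
  fun_prop

theorem momentIntegrand_nonneg (α ν c : ℝ) {y : ℝ} (hy : 0 < y) :
    0 ≤ momentIntegrand α ν c y := by
  unfold momentIntegrand
  positivity

theorem momentIntegrand_add_one (α ν c : ℝ) {y : ℝ} (hy : 0 < y) :
    momentIntegrand α (ν + 1) c y = y * momentIntegrand α ν c y := by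
  simp only [momentIntegrand, Real.rpow_add_one hy.ne']
  ring

theorem integrableOn_momentIntegrand_Ioo {α ν c : ℝ} (hα : -1 < α) (hν : -1 < ν) (hc : 0 < c) :
    IntegrableOn (momentIntegrand α ν c) (Set.Ioo 0 1) := by
  have h := Complex.betaIntegral_convergent (u := ((ν + 1 : ℝ) : ℂ)) (v := ((α + 1 : ℝ) : ℂ))
    (by rw [Complex.ofReal_re]; linarith) (by rw [Complex.ofReal_re]; linarith)
  rw [intervalIntegrable_iff_integrableOn_Ioo_of_le zero_le_one] at h
  -- As e^(-cy) ≤ 1 on (0, 1), the Beta integrand is a majorant.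
  refine Integrable.mono h (measurable_momentIntegrand α ν c).aestronglyMeasurable ?_
  filter_upwards [ae_restrict_mem measurableSet_Ioo] with y hy
  have h1 : ((y : ℂ) ^ (((ν + 1 : ℝ) : ℂ) - 1) * (1 - (y : ℂ)) ^ (((α + 1 : ℝ) : ℂ) - 1)) =
      ((y ^ ν * (1 - y) ^ α : ℝ) : ℂ) := by
    rw [Complex.ofReal_mul, Complex.ofReal_cpow hy.1.le, Complex.ofReal_cpow (by linarith [hy.2])]
    push_cast
    ring_nf
  have h2 : (0 : ℝ) ≤ y ^ ν * (1 - y) ^ α :=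
    mul_nonneg (Real.rpow_nonneg hy.1.le _) (Real.rpow_nonneg (by linarith [hy.2]) _)
  rw [h1, Complex.norm_real, Real.norm_of_nonneg h2,
    Real.norm_of_nonneg (momentIntegrand_nonneg α ν c hy.1), momentIntegrand,
    abs_of_neg (by linarith [hy.2] : y - 1 < 0), neg_sub, mul_comm ((1 - y) ^ α)]
  refine mul_le_of_le_one_right h2 (Real.exp_le_one_iff.2 ?_)
  have := mul_pos hc hy.1
  linarith

theorem integrableOn_momentIntegrand_Ioi {α ν c : ℝ} (hα : -1 < α) (hc : 0 < c) :
    IntegrableOn (momentIntegrand α ν c) (Set.Ioi 1) := by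
  -- With z = y - 1 > 0, the bound (z + 1)^ν ≤ (z + 1)^N ≤ 2^(N-1) (z^N + 1) leaves two Gamma
  -- integrals.
  obtain ⟨N, hN⟩ := exists_nat_ge ν
  have h1 : IntegrableOn (fun z : ℝ => z ^ α * Real.exp (-c * z ^ (1 : ℝ))) (Set.Ioi 0) :=
    integrableOn_rpow_mul_exp_neg_mul_rpow hα one_pos hc
  have h2 : IntegrableOn (fun z : ℝ => z ^ (α + N) * Real.exp (-c * z ^ (1 : ℝ))) (Set.Ioi 0) :=
    integrableOn_rpow_mul_exp_neg_mul_rpow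
      (by have : (0 : ℝ) ≤ N := N.cast_nonneg; linarith) one_pos hc
  have h3 : IntegrableOn (fun z : ℝ => momentIntegrand α ν c (z + 1)) (Set.Ioi 0) := by
    refine Integrable.mono' ((h1.add h2).const_mul (2 ^ (N - 1)))
      ((measurable_momentIntegrand α ν c).comp (measurable_add_const 1)).aestronglyMeasurable ?_
    filter_upwards [ae_restrict_mem measurableSet_Ioi] with z hz
    have hz : 0 < z := hz
    rw [Real.norm_of_nonneg (momentIntegrand_nonneg _ _ _ (by linarith)), momentIntegrand,
      add_sub_cancel_right, abs_of_pos hz, Pi.add_apply, Real.rpow_add hz, Real.rpow_natCast,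
      Real.rpow_one]
    have h4 : (z + 1) ^ ν ≤ 2 ^ (N - 1) * (z ^ N + 1) := by
      calc (z + 1) ^ ν ≤ (z + 1) ^ (N : ℝ) :=
            Real.rpow_le_rpow_of_exponent_le (by linarith) hN
        _ = (z + 1) ^ N := Real.rpow_natCast _ _
        _ ≤ 2 ^ (N - 1) * (z ^ N + 1 ^ N) := add_pow_le hz.le zero_le_one N
        _ = _ := by rw [one_pow]
    have h5 : Real.exp (-(c * (z + 1))) ≤ Real.exp (-c * z) := Real.exp_le_exp.2 (by linarith)
    calc z ^ α * (z + 1) ^ ν * Real.exp (-(c * (z + 1)))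
        ≤ z ^ α * (2 ^ (N - 1) * (z ^ N + 1)) * Real.exp (-c * z) := by gcongr
      _ = _ := by ring
  have h6 := (measurePreserving_sub_right volume (1 : ℝ)).integrableOn_comp_preimage
    (MeasurableEquiv.subRight (1 : ℝ)).measurableEmbedding
    (f := fun z : ℝ => momentIntegrand α ν c (z + 1)) (s := Set.Ioi 0)
  have h7 := h6.2 h3
  have h8 : (fun x : ℝ => x - 1) ⁻¹' Set.Ioi 0 = Set.Ioi 1 := by ext x; simp
  rw [h8] at h7
  simpa [Function.comp_def] using h7

/-- The integral of `|y - 1| ^ α y ^ ν e ^ (-c y)` over `S`. -/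
noncomputable def moment (S : Set ℝ) (α ν c : ℝ) : ℝ := ∫ y in S, momentIntegrand α ν c y

theorem hasDerivAt_moment {S : Set ℝ} (hS : MeasurableSet S) (hS0 : S ⊆ Set.Ioi 0) {α ν c : ℝ}
    (hint : ∀ b, 0 < b → IntegrableOn (momentIntegrand α ν b) S)
    (hint' : ∀ b, 0 < b → IntegrableOn (momentIntegrand α (ν + 1) b) S) (hc : 0 < c) :
    HasDerivAt (moment S α ν) (-moment S α (ν + 1) c) c := by
  -- The integrand decreases in b, so its value at c / 2 dominates the derivative for all b > c / 2.
  have h := hasDerivAt_integral_of_dominated_loc_of_deriv_le (μ := volume.restrict S)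
    (F := fun b y => momentIntegrand α ν b y) (F' := fun b y => -momentIntegrand α (ν + 1) b y)
    (x₀ := c) (s := Set.Ioi (c / 2)) (bound := momentIntegrand α (ν + 1) (c / 2))
    (Ioi_mem_nhds (by linarith))
    (Eventually.of_forall fun b => (measurable_momentIntegrand α ν b).aestronglyMeasurable)
    (hint c hc) (measurable_momentIntegrand α (ν + 1) c).neg.aestronglyMeasurable
    (by
      filter_upwards [ae_restrict_mem hS] with y hy b hb
      have hy : 0 < y := hS0 hy
      have hb : c / 2 < b := hb
      rw [norm_neg, Real.norm_of_nonneg (momentIntegrand_nonneg _ _ _ hy)]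
      unfold momentIntegrand
      gcongr)
    (hint' _ (by linarith))
    (by
      filter_upwards [ae_restrict_mem hS] with y hy b _
      have hy : 0 < y := hS0 hy
      have h1 : HasDerivAt (fun b : ℝ => -(b * y)) (-(1 * y)) b :=
        ((hasDerivAt_id b).mul_const y).neg
      have h2 := h1.exp.const_mul (|y - 1| ^ α * y ^ ν)
      refine h2.congr_deriv ?_
      rw [momentIntegrand_add_one _ _ _ hy, momentIntegrand]
      ring)
  have h2 := h.2
  rw [integral_neg] at h2
  exact h2

/-- This is the primitive behind the integration by parts. The sign ε, later -1 on (0, 1) and 1 on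
(1, ∞), keeps the base of the real power positive. -/
theorem hasDerivAt_rpow_mul_rpow_mul_exp {α ν c ε y : ℝ} (hy : 0 < y) (hε : 0 < ε * (y - 1)) :
    HasDerivAt (fun y : ℝ => (ε * (y - 1)) ^ (α + 1) * y ^ (ν + 1) * Real.exp (-(c * y)))
      ((ε * (y - 1)) ^ α * y ^ ν * Real.exp (-(c * y)) *
        (ε * ((α + 1) * y + (ν + 1) * (y - 1) - c * (y * (y - 1))))) y := by
  have h1 : HasDerivAt (fun y : ℝ => ε * (y - 1)) (ε * 1) y :=
    ((hasDerivAt_id y).sub_const 1).const_mul ε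
  have h2 := h1.rpow_const (p := α + 1) (Or.inl hε.ne')
  have h3 := (hasDerivAt_id y).rpow_const (p := ν + 1) (Or.inl hy.ne')
  have h4 : HasDerivAt (fun y : ℝ => -(c * y)) (-(c * 1)) y :=
    ((hasDerivAt_id y).const_mul c).neg
  refine ((h2.mul h3).mul h4.exp).congr_deriv ?_
  simp only [id, add_sub_cancel_right, Real.rpow_add_one hy.ne', Real.rpow_add_one hε.ne',
    Pi.mul_apply]
  ring

/-- Both exponents are positive, so the primitive extends continuously to the singular points 0 and
1 and vanishes there. -/
theorem continuous_rpow_mul_rpow_mul_exp {α ν c ε : ℝ} (hα : -1 < α) (hν : -1 < ν) :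
    Continuous (fun y : ℝ => (ε * (y - 1)) ^ (α + 1) * y ^ (ν + 1) * Real.exp (-(c * y))) := by
  have h1 : Continuous (fun y : ℝ => (ε * (y - 1)) ^ (α + 1)) :=
    Continuous.rpow_const (by fun_prop) fun _ => Or.inr (by linarith)
  have h2 : Continuous (fun y : ℝ => y ^ (ν + 1)) :=
    Continuous.rpow_const (by fun_prop) fun _ => Or.inr (by linarith)
  fun_prop

theorem moment_pearson_of_integral_eq_zero {S : Set ℝ} (hS : MeasurableSet S)
    (hS0 : S ⊆ Set.Ioi 0) {α ν c : ℝ}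
    (hint : ∀ k : ℕ, IntegrableOn (momentIntegrand α (ν + k) c) S)
    (h0 : ∫ y in S, momentIntegrand α ν c y *
      ((α + 1) * y + (ν + 1) * (y - 1) - c * (y * (y - 1))) = 0) :
    (α + ν + 2 + c) * moment S α (ν + 1) c - (ν + 1) * moment S α ν c -
      c * moment S α (ν + 2) c = 0 := by
  have i0 : IntegrableOn (momentIntegrand α ν c) S := by simpa using hint 0
  have i1 : IntegrableOn (momentIntegrand α (ν + 1) c) S := by simpa using hint 1
  have i2 : IntegrableOn (momentIntegrand α (ν + 2) c) S := by simpa using hint 2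
  rw [← h0]
  unfold moment
  rw [← integral_const_mul, ← integral_const_mul, ← integral_const_mul,
    ← integral_sub (i1.const_mul _) (i0.const_mul _),
    ← integral_sub (by exact (i1.const_mul _).sub (i0.const_mul _)) (i2.const_mul _)]
  refine setIntegral_congr_fun hS fun y hy => ?_
  have hy : 0 < y := hS0 hy
  simp only [show ν + 2 = ν + 1 + 1 by ring, momentIntegrand_add_one _ _ _ hy]
  ring

theorem integrableOn_pearson {S : Set ℝ} (hS : MeasurableSet S)
    (hS0 : S ⊆ Set.Ioi 0) {α ν c : ℝ}
    (hint : ∀ k : ℕ, IntegrableOn (momentIntegrand α (ν + k) c) S) :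
    IntegrableOn (fun y => momentIntegrand α ν c y *
      ((α + 1) * y + (ν + 1) * (y - 1) - c * (y * (y - 1)))) S := by
  have i0 : IntegrableOn (momentIntegrand α ν c) S := by simpa using hint 0
  have i1 : IntegrableOn (momentIntegrand α (ν + 1) c) S := by simpa using hint 1
  have i2 : IntegrableOn (momentIntegrand α (ν + 2) c) S := by simpa using hint 2
  refine IntegrableOn.congr_fun (((i1.const_mul (α + ν + 2 + c)).sub
    (i0.const_mul (ν + 1))).sub (i2.const_mul c)) (fun y hy => ?_) hS
  have hy : 0 < y := hS0 hy
  simp only [show ν + 2 = ν + 1 + 1 by ring, momentIntegrand_add_one _ _ _ hy, Pi.sub_apply]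
  ring

theorem moment_pearson_Ioo {α ν c : ℝ} (hα : -1 < α) (hν : -1 < ν) (hc : 0 < c) :
    (α + ν + 2 + c) * moment (Set.Ioo 0 1) α (ν + 1) c - (ν + 1) * moment (Set.Ioo 0 1) α ν c -
      c * moment (Set.Ioo 0 1) α (ν + 2) c = 0 := by
  have hint : ∀ k : ℕ, IntegrableOn (momentIntegrand α (ν + k) c) (Set.Ioo 0 1) := fun k =>
    integrableOn_momentIntegrand_Ioo hα (by have : (0 : ℝ) ≤ k := k.cast_nonneg; linarith) hc
  have hsub : Set.Ioo (0 : ℝ) 1 ⊆ Set.Ioi 0 := fun y hy => hy.1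
  refine moment_pearson_of_integral_eq_zero measurableSet_Ioo hsub hint ?_
  have hint' := integrableOn_pearson measurableSet_Ioo hsub hint
  have h := intervalIntegral.integral_eq_sub_of_hasDerivAt_of_le zero_le_one
    (continuous_rpow_mul_rpow_mul_exp (c := c) (ε := -1) hα hν).continuousOn
    (f' := fun y => -(momentIntegrand α ν c y *
      ((α + 1) * y + (ν + 1) * (y - 1) - c * (y * (y - 1))))) (fun y hy => by
      have h1 : 0 < -1 * (y - 1) := by linarith [hy.2]
      refine (hasDerivAt_rpow_mul_rpow_mul_exp (α := α) (ν := ν) (c := c) hy.1 h1).congr_deriv ?_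
      rw [momentIntegrand, abs_of_neg (by linarith : y - 1 < 0), neg_one_mul]
      ring) ((intervalIntegrable_iff_integrableOn_Ioo_of_le zero_le_one).2 hint'.neg)
  rw [intervalIntegral.integral_of_le zero_le_one, integral_Ioc_eq_integral_Ioo, integral_neg,
    sub_self, mul_zero, Real.zero_rpow (by linarith), Real.zero_rpow (by linarith)] at h
  simpa using h

theorem moment_pearson_Ioi {α ν c : ℝ} (hα : -1 < α) (hν : -1 < ν) (hc : 0 < c) :
    (α + ν + 2 + c) * moment (Set.Ioi 1) α (ν + 1) c - (ν + 1) * moment (Set.Ioi 1) α ν c -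
      c * moment (Set.Ioi 1) α (ν + 2) c = 0 := by
  have hint : ∀ k : ℕ, IntegrableOn (momentIntegrand α (ν + k) c) (Set.Ioi 1) := fun k =>
    integrableOn_momentIntegrand_Ioi hα hc
  have hsub : Set.Ioi (1 : ℝ) ⊆ Set.Ioi 0 := Set.Ioi_subset_Ioi zero_le_one
  refine moment_pearson_of_integral_eq_zero measurableSet_Ioi hsub hint ?_
  have hint' := integrableOn_pearson measurableSet_Ioi hsub hint
  have hlim : Tendsto (fun y : ℝ => (1 * (y - 1)) ^ (α + 1) * y ^ (ν + 1) *
      Real.exp (-(c * y))) atTop (𝓝 0) := by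
    refine squeeze_zero' ?_ ?_ (tendsto_rpow_mul_exp_neg_mul_atTop_nhds_zero (α + ν + 2) c hc)
    · filter_upwards [eventually_gt_atTop 1] with y hy
      have h1 : 0 ≤ 1 * (y - 1) := by linarith
      have h2 : 0 < y := by linarith
      positivity
    · filter_upwards [eventually_gt_atTop 1] with y hy
      have h2 : 0 < y := by linarith
      rw [show α + ν + 2 = (α + 1) + (ν + 1) by ring, Real.rpow_add h2 (α + 1), neg_mul]
      have h3 : (1 * (y - 1)) ^ (α + 1) ≤ y ^ (α + 1) :=
        Real.rpow_le_rpow (by linarith) (by linarith) (by linarith)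
      exact mul_le_mul_of_nonneg_right (mul_le_mul_of_nonneg_right h3 (by positivity))
        (Real.exp_pos _).le
  have h := integral_Ioi_of_hasDerivAt_of_tendsto
    (continuous_rpow_mul_rpow_mul_exp (c := c) (ε := 1) hα hν).continuousWithinAt
    (f' := fun y => momentIntegrand α ν c y *
      ((α + 1) * y + (ν + 1) * (y - 1) - c * (y * (y - 1)))) (a := 1) (fun y hy => by
      have hy : 1 < y := hy
      have h1 : 0 < 1 * (y - 1) := by linarith
      refine (hasDerivAt_rpow_mul_rpow_mul_exp (α := α) (ν := ν) (c := c)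
        (by linarith) h1).congr_deriv ?_
      rw [momentIntegrand, abs_of_pos (by linarith : 0 < y - 1), one_mul, one_mul]) hint' hlim
  rw [h, sub_self, mul_zero, Real.zero_rpow (by linarith)]
  simp

end OrthoPoly

/-! ### The functional of the deformed Laguerre weight -/

namespace OrthoPoly
open MeasureTheory

theorem X_mul_derivative_C_mul_X_pow (a : ℂ) (k : ℕ) :
    X * derivative (C a * X ^ k) = C (k * a) * X ^ k := by
  ext i
  rw [coeff_X_mul_derivative, coeff_C_mul_X_pow, coeff_C_mul_X_pow]
  split_ifs with h
  · rw [h]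
  · simp

/-- The `k`-th moment `∫_0^∞ y ^ k v(y) e ^ (-c y) dy`, where `v` is the algebraic part of the
deformed Laguerre weight with its singular point scaled to `1`. -/
noncomputable def scaledMoment (ζ α μ : ℝ) (ω : ℂ) (k : ℕ) (c : ℝ) : ℂ :=
  ω * (moment (Set.Ioo 0 1) α (μ + k) c : ℝ) + (1 - ζ) * (moment (Set.Ioi 1) α (μ + k) c : ℝ)

theorem integrableOn_momentIntegrand_nat {α μ c : ℝ} (hα : -1 < α) (hμ : -1 < μ) (hc : 0 < c)
    (k : ℕ) :
    IntegrableOn (momentIntegrand α (μ + k) c) (Set.Ioo 0 1) ∧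
      IntegrableOn (momentIntegrand α (μ + k) c) (Set.Ioi 1) :=
  ⟨integrableOn_momentIntegrand_Ioo hα (by have : (0 : ℝ) ≤ k := k.cast_nonneg; linarith) hc,
    integrableOn_momentIntegrand_Ioi hα hc⟩

theorem scaledMoment_pearson {ζ α μ : ℝ} {ω : ℂ} (hα : -1 < α) (hμ : -1 < μ) {c : ℝ}
    (hc : 0 < c) (k : ℕ) :
    (α + (μ + k) + 2 + c) * scaledMoment ζ α μ ω (k + 1) c -
      (μ + k + 1) * scaledMoment ζ α μ ω k c - c * scaledMoment ζ α μ ω (k + 2) c = 0 := by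
  have hν : -1 < μ + k := by have : (0 : ℝ) ≤ k := k.cast_nonneg; linarith
  have h1 := congrArg (fun r : ℝ => (r : ℂ)) (moment_pearson_Ioo hα hν hc)
  have h2 := congrArg (fun r : ℝ => (r : ℂ)) (moment_pearson_Ioi hα hν hc)
  push_cast at h1 h2
  simp only [scaledMoment, Nat.cast_add, Nat.cast_one, Nat.cast_ofNat, ← add_assoc] at *
  linear_combination ω * h1 + (1 - (ζ : ℂ)) * h2

theorem hasDerivAt_scaledMoment {ζ α μ : ℝ} {ω : ℂ} (hα : -1 < α) (hμ : -1 < μ) {c : ℝ}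
    (hc : 0 < c) (k : ℕ) :
    HasDerivAt (scaledMoment ζ α μ ω k) (-scaledMoment ζ α μ ω (k + 1) c) c := by
  have hk : μ + ((k + 1 : ℕ) : ℝ) = μ + k + 1 := by push_cast; ring
  have h1 := hasDerivAt_moment (S := Set.Ioo 0 1) measurableSet_Ioo (fun y hy => hy.1)
    (fun b hb => (integrableOn_momentIntegrand_nat hα hμ hb k).1)
    (fun b hb => by
      have := (integrableOn_momentIntegrand_nat hα hμ hb (k + 1)).1
      rwa [hk] at this) hc
  have h2 := hasDerivAt_moment (S := Set.Ioi 1) measurableSet_Ioi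
    (Set.Ioi_subset_Ioi zero_le_one)
    (fun b hb => (integrableOn_momentIntegrand_nat hα hμ hb k).2)
    (fun b hb => by
      have := (integrableOn_momentIntegrand_nat hα hμ hb (k + 1)).2
      rwa [hk] at this) hc
  refine ((h1.ofReal_comp.const_mul ω).add (h2.ofReal_comp.const_mul (1 - (ζ : ℂ)))).congr_deriv ?_
  rw [scaledMoment, hk]
  push_cast
  ring

/-- The moment functional `f ↦ ∫_0^∞ f(x) w_t(x) dx` of the deformed Laguerre weight, for
`t > 0`. -/
noncomputable def laguerreFunctional (ζ α μ : ℝ) (ω : ℂ) (t : ℝ) : ℂ[X] →ₗ[ℂ] ℂ :=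
  (Polynomial.basisMonomials ℂ).constr ℂ fun k =>
    ((t ^ (α + μ + 1 + k) : ℝ) : ℂ) * scaledMoment ζ α μ ω k t

theorem laguerreFunctional_X_pow (ζ α μ : ℝ) (ω : ℂ) (t : ℝ) (k : ℕ) :
    laguerreFunctional ζ α μ ω t (X ^ k) =
      ((t ^ (α + μ + 1 + k) : ℝ) : ℂ) * scaledMoment ζ α μ ω k t := by
  have h := (Polynomial.basisMonomials ℂ).constr_basis ℂ (fun k : ℕ =>
    ((t ^ (α + μ + 1 + k) : ℝ) : ℂ) * scaledMoment ζ α μ ω k t) k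
  rw [coe_basisMonomials] at h
  rw [X_pow_eq_monomial]
  exact h

theorem rpow_add_succ {t : ℝ} (ht : 0 < t) (β : ℝ) (k : ℕ) :
    ((t ^ (β + (k + 1 : ℕ)) : ℝ) : ℂ) = ((t ^ (β + k) : ℝ) : ℂ) * t := by
  rw [← Complex.ofReal_mul, ← Real.rpow_add_one ht.ne']
  push_cast
  ring_nf

theorem isPearson_laguerreFunctional {ζ α μ : ℝ} {ω : ℂ} (hα : -1 < α) (hμ : -1 < μ) {t : ℝ}
    (ht : 0 < t) : IsPearson α μ t (laguerreFunctional ζ α μ ω t) := by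
  intro f
  induction f using Polynomial.induction_on' with
  | add f g hf hg =>
    have h := congrArg₂ (· + ·) hf hg
    simp only [← map_add, add_zero] at h
    rw [← h, derivative_add]
    congr 1
    ring
  | monomial k a =>
    rw [← C_mul_X_pow_eq_monomial]
    have e : X * (X - C (t : ℂ)) * derivative (C a * X ^ k) +
        (C (α + 1 : ℂ) * X + C (μ + 1 : ℂ) * (X - C (t : ℂ)) - X * (X - C (t : ℂ))) *
          (C a * X ^ k) =
        (a * (α + (μ + k) + 2 + t)) • (X ^ (k + 1) : ℂ[X]) - (a * (μ + k + 1) * t) • X ^ k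
          - a • X ^ (k + 2) := by
      rw [mul_comm X, mul_assoc, X_mul_derivative_C_mul_X_pow]
      simp only [smul_eq_C_mul, map_mul, map_add, map_one, map_natCast, C_ofNat]
      ring
    rw [e, map_sub, map_sub, map_smul, map_smul, map_smul, laguerreFunctional_X_pow,
      laguerreFunctional_X_pow, laguerreFunctional_X_pow, rpow_add_succ ht, rpow_add_succ ht,
      rpow_add_succ ht]
    simp only [smul_eq_mul]
    linear_combination (a * ((t ^ (α + μ + 1 + k) : ℝ) : ℂ) * t) *
      scaledMoment_pearson (ζ := ζ) (ω := ω) hα hμ ht k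

/-- On X^k, differentiating t^(α+μ+1+k) produces the terms with f and x f', and differentiating
e^(-ty) under the integral produces -x f. -/
theorem hasDerivAt_laguerreFunctional {ζ α μ : ℝ} {ω : ℂ} (hα : -1 < α) (hμ : -1 < μ) {t : ℝ}
    (ht : 0 < t) (f : ℂ[X]) :
    HasDerivAt (fun s => laguerreFunctional ζ α μ ω s f)
      (((α + μ + 1) * laguerreFunctional ζ α μ ω t f +
        laguerreFunctional ζ α μ ω t (X * derivative f) -
        laguerreFunctional ζ α μ ω t (X * f)) / t) t := by
  have ht0 : (t : ℂ) ≠ 0 := by exact_mod_cast ht.ne'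
  induction f using Polynomial.induction_on' with
  | add f g hf hg =>
    simp only [map_add, mul_add]
    exact (hf.add hg).congr_deriv (by ring)
  | monomial k a =>
    rw [← C_mul_X_pow_eq_monomial, X_mul_derivative_C_mul_X_pow,
      show X * (C a * X ^ k) = C a * X ^ (k + 1) by ring]
    simp only [← smul_eq_C_mul, map_smul, laguerreFunctional_X_pow]
    have h1 := ((hasDerivAt_id t).rpow_const (p := α + μ + 1 + k) (Or.inl ht.ne')).ofReal_comp
    refine ((h1.mul (hasDerivAt_scaledMoment (ζ := ζ) (ω := ω) hα hμ ht k)).const_mul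
      a).congr_deriv ?_
    simp only [id, smul_eq_mul]
    rw [rpow_add_succ ht, Real.rpow_sub_one ht.ne']
    push_cast
    field_simp
    ring

theorem deformedLaguerreWeight_mul_of_lt {ζ α μ : ℝ} {ω : ℂ} {s y : ℝ} (hs : 0 < s) (hy : 0 < y)
    (h : y < 1) (k : ℕ) :
    ((s * y : ℝ) : ℂ) ^ k * deformedLaguerreWeight ζ α μ ω s (s * y) =
      ((s ^ (α + μ + k) : ℝ) : ℂ) * ω * (momentIntegrand α (μ + k) s y : ℝ) := by
  have h1 : s * y - s = -(s * |y - 1|) := by rw [abs_of_neg (by linarith)]; ring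
  have h2 : 0 < |y - 1| := abs_pos.2 (by linarith)
  have h3 : 0 < s * |y - 1| := by positivity
  rw [deformedLaguerreWeight, h1, if_neg (by linarith), branchPow, if_pos (by linarith), neg_neg,
    momentIntegrand, Real.mul_rpow hs.le h2.le, Real.mul_rpow hs.le hy.le, Real.rpow_add hs,
    Real.rpow_add hs, Real.rpow_add hy, Real.rpow_natCast, Real.rpow_natCast]
  push_cast
  ring

theorem deformedLaguerreWeight_mul_of_gt {ζ α μ : ℝ} {ω : ℂ} {s y : ℝ} (hs : 0 < s)
    (h : 1 < y) (k : ℕ) :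
    ((s * y : ℝ) : ℂ) ^ k * deformedLaguerreWeight ζ α μ ω s (s * y) =
      ((s ^ (α + μ + k) : ℝ) : ℂ) * (1 - ζ) * (momentIntegrand α (μ + k) s y : ℝ) := by
  have hy : 0 < y := by linarith
  have h1 : s * y - s = s * |y - 1| := by rw [abs_of_pos (by linarith)]; ring
  have h2 : 0 < |y - 1| := abs_pos.2 (by linarith)
  have h3 : 0 < s * |y - 1| := by positivity
  rw [deformedLaguerreWeight, h1, if_pos h3, branchPow, if_neg (by linarith),
    momentIntegrand, Real.mul_rpow hs.le h2.le, Real.mul_rpow hs.le hy.le, Real.rpow_add hs,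
    Real.rpow_add hs, Real.rpow_add hy, Real.rpow_natCast, Real.rpow_natCast]
  push_cast
  ring

/-- Substitution x = sy; the Jacobian and the homogeneity of the weight's algebraic part give the
power of s. -/
theorem integral_pow_mul_deformedLaguerreWeight {ζ α μ : ℝ} {ω : ℂ} (hα : -1 < α) (hμ : -1 < μ)
    {s : ℝ} (hs : 0 < s) (k : ℕ) :
    IntegrableOn (fun x : ℝ => (x : ℂ) ^ k * deformedLaguerreWeight ζ α μ ω s x) (Set.Ioi 0) ∧
    ∫ x in Set.Ioi (0 : ℝ), (x : ℂ) ^ k * deformedLaguerreWeight ζ α μ ω s x =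
      laguerreFunctional ζ α μ ω s (X ^ k) := by
  set G : ℝ → ℂ := fun x => (x : ℂ) ^ k * deformedLaguerreWeight ζ α μ ω s x with hG
  obtain ⟨i1, i2⟩ := integrableOn_momentIntegrand_nat hα hμ hs k
  have e1 : Set.EqOn (fun y => ((s ^ (α + μ + k) : ℝ) : ℂ) * ω *
      (momentIntegrand α (μ + k) s y : ℝ)) (fun y => G (s * y)) (Set.Ioo 0 1) := fun y hy =>
    (deformedLaguerreWeight_mul_of_lt hs hy.1 hy.2 k).symm
  have e2 : Set.EqOn (fun y => ((s ^ (α + μ + k) : ℝ) : ℂ) * (1 - ζ) *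
      (momentIntegrand α (μ + k) s y : ℝ)) (fun y => G (s * y)) (Set.Ioi 1) := fun y hy =>
    (deformedLaguerreWeight_mul_of_gt hs hy k).symm
  have j1 : IntegrableOn (fun y => G (s * y)) (Set.Ioo 0 1) :=
    IntegrableOn.congr_fun (i1.ofReal.const_mul _) e1 measurableSet_Ioo
  have j2 : IntegrableOn (fun y => G (s * y)) (Set.Ici 1) :=
    (integrableOn_Ici_iff_integrableOn_Ioi).2
      (IntegrableOn.congr_fun (i2.ofReal.const_mul _) e2 measurableSet_Ioi)
  have hu : Set.Ioo (0 : ℝ) 1 ∪ Set.Ici 1 = Set.Ioi 0 := Set.Ioo_union_Ici_eq_Ioi one_pos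
  have hd : Disjoint (Set.Ioo (0 : ℝ) 1) (Set.Ici 1) :=
    Set.disjoint_left.2 fun y hy hy' => not_lt.2 hy' hy.2
  have j : IntegrableOn (fun y => G (s * y)) (Set.Ioi 0) := hu ▸ j1.union j2
  have hI : ∫ y in Set.Ioi (0 : ℝ), G (s * y) =
      ((s ^ (α + μ + k) : ℝ) : ℂ) * scaledMoment ζ α μ ω k s := by
    rw [← hu, setIntegral_union hd measurableSet_Ici j1 j2, integral_Ici_eq_integral_Ioi,
      ← setIntegral_congr_fun measurableSet_Ioo e1, ← setIntegral_congr_fun measurableSet_Ioi e2,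
      integral_const_mul, integral_const_mul, integral_complex_ofReal, integral_complex_ofReal,
      scaledMoment, moment, moment]
    ring
  constructor
  · have := (integrableOn_Ioi_comp_mul_left_iff G 0 hs).1 j
    rwa [mul_zero] at this
  · have h := integral_comp_mul_left_Ioi G 0 hs
    rw [hI, mul_zero] at h
    have hs0 : (s : ℂ) ≠ 0 := by exact_mod_cast hs.ne'
    rw [laguerreFunctional_X_pow, show α + μ + 1 + k = α + μ + k + 1 by ring,
      Real.rpow_add_one hs.ne', Complex.ofReal_mul, mul_right_comm, h, Complex.real_smul,
      Complex.ofReal_inv]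
    field_simp

theorem integral_eval_mul_deformedLaguerreWeight {ζ α μ : ℝ} {ω : ℂ} (hα : -1 < α) (hμ : -1 < μ)
    {s : ℝ} (hs : 0 < s) (f : ℂ[X]) :
    IntegrableOn (fun x : ℝ => f.eval (x : ℂ) * deformedLaguerreWeight ζ α μ ω s x)
      (Set.Ioi 0) ∧
    ∫ x in Set.Ioi (0 : ℝ), f.eval (x : ℂ) * deformedLaguerreWeight ζ α μ ω s x =
      laguerreFunctional ζ α μ ω s f := by
  induction f using Polynomial.induction_on' with
  | add f g hf hg =>
    simp only [eval_add, add_mul, map_add]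
    exact ⟨hf.1.add hg.1, by rw [integral_add hf.1 hg.1, hf.2, hg.2]⟩
  | monomial k a =>
    obtain ⟨h1, h2⟩ := integral_pow_mul_deformedLaguerreWeight (ζ := ζ) (ω := ω) hα hμ hs k
    rw [← C_mul_X_pow_eq_monomial, ← smul_eq_C_mul, map_smul, ← h2]
    simp only [eval_smul, eval_pow, eval_X, smul_eq_mul, mul_assoc]
    exact ⟨h1.const_mul a, integral_const_mul a _⟩

theorem IsOrthonormalUpTo.isOrthonormalFor {ζ α μ : ℝ} {ω : ℂ} (hα : -1 < α) (hμ : -1 < μ)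
    {s : ℝ} (hs : 0 < s) {N : ℕ} {p : ℕ → ℂ[X]}
    (h : IsOrthonormalUpTo N (deformedLaguerreWeight ζ α μ ω s) p) :
    IsOrthonormalFor (laguerreFunctional ζ α μ ω s) N p where
  degree_eq := h.degree_eq
  orthonormal i hi j hj := by
    rw [← h.orthonormal i hi j hj, weightForm,
      ← (integral_eval_mul_deformedLaguerreWeight hα hμ hs _).2]
    simp only [eval_mul]

end OrthoPoly

/-! ### Differentiability in the parameter and the deformation equation -/

namespace OrthoPoly

/-- The family `q` of polynomials of bounded degree is differentiable at `t`, with derivative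
`q'`, coefficient by coefficient. -/
def HasPolyDerivAt (q : ℝ → ℂ[X]) (q' : ℂ[X]) (t : ℝ) : Prop :=
  (∃ N, ∀ᶠ s in 𝓝 t, (q s).natDegree ≤ N) ∧
    ∀ i, HasDerivAt (fun s => (q s).coeff i) (q'.coeff i) t

namespace HasPolyDerivAt

variable {q r : ℝ → ℂ[X]} {q' r' : ℂ[X]} {t : ℝ}

theorem const (f : ℂ[X]) (t : ℝ) : HasPolyDerivAt (fun _ => f) 0 t :=
  ⟨⟨f.natDegree, Eventually.of_forall fun _ => le_rfl⟩, fun i => by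
    simpa using hasDerivAt_const t (f.coeff i)⟩

theorem C_comp {c : ℝ → ℂ} {c' : ℂ} (hc : HasDerivAt c c' t) :
    HasPolyDerivAt (fun s => C (c s)) (C c') t :=
  ⟨⟨0, Eventually.of_forall fun _ => by simp⟩, fun i => by
    cases i with
    | zero => simpa using hc
    | succ i => simpa using hasDerivAt_const t (0 : ℂ)⟩

theorem sub (hq : HasPolyDerivAt q q' t) (hr : HasPolyDerivAt r r' t) :
    HasPolyDerivAt (fun s => q s - r s) (q' - r') t := by
  obtain ⟨⟨M, hM⟩, hq⟩ := hq
  obtain ⟨⟨N, hN⟩, hr⟩ := hr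
  refine ⟨⟨max M N, ?_⟩, fun i => by
    simpa only [coeff_sub] using (hq i).fun_sub (hr i)⟩
  filter_upwards [hM, hN] with s h1 h2
  exact (natDegree_sub_le _ _).trans (max_le_max h1 h2)

theorem add (hq : HasPolyDerivAt q q' t) (hr : HasPolyDerivAt r r' t) :
    HasPolyDerivAt (fun s => q s + r s) (q' + r') t := by
  obtain ⟨⟨M, hM⟩, hq⟩ := hq
  obtain ⟨⟨N, hN⟩, hr⟩ := hr
  refine ⟨⟨max M N, ?_⟩, fun i => by
    simpa only [coeff_add] using (hq i).fun_add (hr i)⟩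
  filter_upwards [hM, hN] with s h1 h2
  exact (natDegree_add_le _ _).trans (max_le_max h1 h2)

theorem mul (hq : HasPolyDerivAt q q' t) (hr : HasPolyDerivAt r r' t) :
    HasPolyDerivAt (fun s => q s * r s) (q' * r t + q t * r') t := by
  obtain ⟨⟨M, hM⟩, hq⟩ := hq
  obtain ⟨⟨N, hN⟩, hr⟩ := hr
  refine ⟨⟨M + N, ?_⟩, fun i => ?_⟩
  · filter_upwards [hM, hN] with s h1 h2
    exact natDegree_mul_le.trans (add_le_add h1 h2)
  · simp only [coeff_add, coeff_mul, ← Finset.sum_add_distrib]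
    exact HasDerivAt.fun_sum fun x _ => (hq x.1).mul (hr x.2)

theorem congr (hq : HasPolyDerivAt q q' t) (h : ∀ᶠ s in 𝓝 t, r s = q s) :
    HasPolyDerivAt r q' t := by
  obtain ⟨⟨M, hM⟩, hq⟩ := hq
  refine ⟨⟨M, ?_⟩, fun i => (hq i).congr_of_eventuallyEq (h.mono fun s hs => by simp only [hs])⟩
  filter_upwards [hM, h] with s h1 h2
  rwa [h2]

/-- Product rule for the pairing of a moving functional with a moving polynomial. The degree bound
makes it a finite sum of products. -/
theorem functional {L : ℝ → ℂ[X] →ₗ[ℂ] ℂ} {L' : ℂ[X] → ℂ}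
    (hL : ∀ f, HasDerivAt (fun s => L s f) (L' f) t) (hq : HasPolyDerivAt q q' t) :
    HasDerivAt (fun s => L s (q s)) (L' (q t) + L t q') t := by
  obtain ⟨⟨N, hN⟩, hq⟩ := hq
  have hsum : ∀ (s : ℝ) (f : ℂ[X]), f.natDegree ≤ N →
      L s f = ∑ i ∈ Finset.range (N + 1), f.coeff i * L s (X ^ i) := by
    intro s f hf
    conv_lhs => rw [f.as_sum_range' (N + 1) (by omega)]
    rw [map_sum]
    refine Finset.sum_congr rfl fun i _ => ?_
    rw [← C_mul_X_pow_eq_monomial, ← smul_eq_C_mul, map_smul, smul_eq_mul]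
  -- Coefficients above N vanish near t, and so do their derivatives.
  have hq' : q'.natDegree ≤ N := by
    refine natDegree_le_iff_coeff_eq_zero.2 fun i hi => ?_
    have h0 : HasDerivAt (fun s => (q s).coeff i) 0 t :=
      (hasDerivAt_const t (0 : ℂ)).congr_of_eventuallyEq (hN.mono fun s hs =>
        coeff_eq_zero_of_natDegree_lt (by omega))
    exact (hq i).unique h0
  have h1 : HasDerivAt (fun s => L s (q t))
      (∑ i ∈ Finset.range (N + 1), (q t).coeff i * L' (X ^ i)) t := by
    simp only [fun s => hsum s (q t) hN.self_of_nhds]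
    exact HasDerivAt.fun_sum fun i _ => (hL (X ^ i)).const_mul _
  have h2 : HasDerivAt (fun s => ∑ i ∈ Finset.range (N + 1), (q s).coeff i * L s (X ^ i))
      (∑ i ∈ Finset.range (N + 1),
        (q'.coeff i * L t (X ^ i) + (q t).coeff i * L' (X ^ i))) t :=
    HasDerivAt.fun_sum fun i _ => (hq i).mul (hL (X ^ i))
  rw [(hL (q t)).unique h1, hsum t q' hq', add_comm, ← Finset.sum_add_distrib]
  exact h2.congr_of_eventuallyEq (hN.mono fun s hs => hsum s _ hs)

theorem eval (hq : HasPolyDerivAt q q' t) (x : ℂ) :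
    HasDerivAt (fun s => (q s).eval x) (q'.eval x) t := by
  have h := hq.functional (L := fun _ => Polynomial.leval x) (L' := fun _ => 0)
    fun f => hasDerivAt_const t _
  simpa using h

end HasPolyDerivAt

theorem IsOrthonormalFor.eq_sum {L : ℂ[X] →ₗ[ℂ] ℂ} {N : ℕ} {p : ℕ → ℂ[X]}
    (h : IsOrthonormalFor L N p) (k : ℕ) : k ≤ N + 1 → ∀ f : ℂ[X], (∀ i, k ≤ i → f.coeff i = 0) →
    f = ∑ j ∈ Finset.range k, C (L (p j * f)) * p j := by
  induction k with
  | zero =>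
    intro _ f hf
    ext i
    simpa using hf i (Nat.zero_le i)
  | succ k ih =>
    intro hk f hf
    have hg := h.gam_ne_zero (show k ≤ N by omega)
    have h1 := ih (by omega) (f - C (f.coeff k / gam p k) * p k) (by
      intro i hi
      rw [coeff_sub, coeff_C_mul]
      rcases hi.eq_or_lt with rfl | hi
      · rw [h.coeff_self (by omega)]; field_simp; ring
      · rw [hf i hi, h.coeff_of_lt (by omega) hi]; ring)
    rw [Finset.sum_range_succ,
      h.functional_mul_of_natDegree_le (show k ≤ N by omega) f fun i hi => hf i hi,
      ← sub_eq_iff_eq_add, h1]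
    refine Finset.sum_congr rfl fun j hj => ?_
    rw [Finset.mem_range] at hj
    have h2 : p j * (f - C (f.coeff k / gam p k) * p k) =
        p j * f - (f.coeff k / gam p k) • (p j * p k) := by
      rw [smul_eq_C_mul]; ring
    rw [h2, map_sub, map_smul, h.orthonormal j (by omega) k (by omega), if_neg (by omega),
      smul_zero, sub_zero]

/-- The Gram–Schmidt step: apart from the scalar γ_k, p_k is built from the functional and the lower
p_j. -/
theorem IsOrthonormalFor.eq_gam_mul {L : ℂ[X] →ₗ[ℂ] ℂ} {N : ℕ} {p : ℕ → ℂ[X]}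
    (h : IsOrthonormalFor L N p) {k : ℕ} (hk : k ≤ N) :
    p k = C (gam p k) * (X ^ k - ∑ j ∈ Finset.range k, C (L (p j * X ^ k)) * p j) := by
  have hg := h.gam_ne_zero hk
  have h1 := h.eq_sum k (by omega) (X ^ k - C (gam p k)⁻¹ * p k) (by
    intro i hi
    rw [coeff_sub, coeff_C_mul, coeff_X_pow]
    rcases hi.eq_or_lt with rfl | hi
    · rw [h.coeff_self hk, if_pos rfl, inv_mul_cancel₀ hg, sub_self]
    · rw [h.coeff_of_lt hk hi, if_neg (by omega)]; ring)
  have h2 : ∑ j ∈ Finset.range k, C (L (p j * (X ^ k - C (gam p k)⁻¹ * p k))) * p j =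
      ∑ j ∈ Finset.range k, C (L (p j * X ^ k)) * p j := by
    refine Finset.sum_congr rfl fun j hj => ?_
    rw [Finset.mem_range] at hj
    have h3 : p j * (X ^ k - C (gam p k)⁻¹ * p k) = p j * X ^ k - (gam p k)⁻¹ • (p j * p k) := by
      rw [smul_eq_C_mul]; ring
    rw [h3, map_sub, map_smul, h.orthonormal j (by omega) k hk, if_neg (by omega), smul_zero,
      sub_zero]
  rw [← h2, ← h1, sub_sub_cancel, ← mul_assoc, ← C_mul, mul_inv_cancel₀ hg, C_1, one_mul]

/-- On the right half-plane the principal root inverts squaring, so g(s) = g(t) ((g(s) /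
g(t))²)^(1/2) near t, and that root is holomorphic at 1. -/
theorem differentiableAt_of_sq {g : ℝ → ℂ} {t : ℝ} (h0 : g t ≠ 0)
    (hsign : ∀ᶠ s in 𝓝 t, 0 < (g s / g t).re) (hsq : DifferentiableAt ℝ (fun s => g s ^ 2) t) :
    DifferentiableAt ℝ g t := by
  have h1 : DifferentiableAt ℂ (fun z : ℂ => z ^ (2⁻¹ : ℂ)) ((g t / g t) ^ 2) := by
    rw [div_self h0, one_pow]
    exact (hasStrictDerivAt_id (1 : ℂ)).cpow_const (c := 2⁻¹) Complex.one_mem_slitPlane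
      |>.hasDerivAt.differentiableAt
  have h2 : DifferentiableAt ℝ (fun s => (g s / g t) ^ 2) t := by
    simp only [div_pow]
    exact hsq.div_const _
  have h3 := ((h1.restrictScalars ℝ).comp t h2).const_mul (g t)
  refine h3.congr_of_eventuallyEq (hsign.mono fun s hs => ?_)
  simp only [Function.comp_apply]
  rw [Complex.sq_cpow_two_inv hs]
  field_simp

/-- Strong induction along Gram–Schmidt. The monic part P is differentiable by induction, and γ_k²
L(P²) = 1 then makes γ_k² differentiable. -/
theorem exists_hasPolyDerivAt {L : ℝ → ℂ[X] →ₗ[ℂ] ℂ} {L' : ℂ[X] → ℂ} {t : ℝ}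
    (hL : ∀ f, HasDerivAt (fun s => L s f) (L' f) t) {N : ℕ} {p : ℝ → ℕ → ℂ[X]}
    (hp : ∀ᶠ s in 𝓝 t, IsOrthonormalFor (L s) N (p s)) {n : ℕ} (hn : n ≤ N)
    (hsign : ∀ᶠ s in 𝓝 t, ∀ k ≤ n, 0 < (gam (p s) k / gam (p t) k).re) (k : ℕ) (hk : k ≤ n) :
    ∃ q', HasPolyDerivAt (fun s => p s k) q' t := by
  induction k using Nat.strong_induction_on with
  | _ k ih =>
    have hsum : ∀ m ≤ k, ∃ r', HasPolyDerivAt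
        (fun s => ∑ j ∈ Finset.range m, C (L s (p s j * X ^ k)) * p s j) r' t := by
      intro m
      induction m with
      | zero => exact fun _ => ⟨0, by simpa using HasPolyDerivAt.const 0 t⟩
      | succ m ihm =>
        intro hm
        obtain ⟨r', hr⟩ := ihm (by omega)
        obtain ⟨q', hq⟩ := ih m (by omega) (by omega)
        have hc := (hq.mul (HasPolyDerivAt.const (X ^ k) t)).functional hL
        simp only [Finset.sum_range_succ]
        exact ⟨_, hr.add ((HasPolyDerivAt.C_comp hc).mul hq)⟩
    obtain ⟨r', hr⟩ := hsum k le_rfl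
    have hP := (HasPolyDerivAt.const (X ^ k) t).sub hr
    set P : ℝ → ℂ[X] := fun s => X ^ k - ∑ j ∈ Finset.range k, C (L s (p s j * X ^ k)) * p s j
    have hpP : ∀ᶠ s in 𝓝 t, p s k = C (gam (p s) k) * P s :=
      hp.mono fun s hs => hs.eq_gam_mul (hk.trans hn)
    have hg := (hP.mul hP).functional hL
    have hgam : ∀ᶠ s in 𝓝 t, gam (p s) k ^ 2 * L s (P s * P s) = 1 := by
      filter_upwards [hp, hpP] with s hs hs'
      have h1 := hs.orthonormal k (hk.trans hn) k (hk.trans hn)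
      rw [if_pos rfl, hs', show C (gam (p s) k) * P s * (C (gam (p s) k) * P s) =
        (gam (p s) k ^ 2) • (P s * P s) by rw [smul_eq_C_mul, C_pow]; ring, map_smul] at h1
      exact h1
    have hne : L t (P t * P t) ≠ 0 := right_ne_zero_of_mul_eq_one hgam.self_of_nhds
    have hsq : DifferentiableAt ℝ (fun s => gam (p s) k ^ 2) t :=
      (hg.inv hne).differentiableAt.congr_of_eventuallyEq
        (hgam.mono fun s hs => eq_inv_of_mul_eq_one_left hs)
    have hd := differentiableAt_of_sq (hp.self_of_nhds.gam_ne_zero (hk.trans hn))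
      (hsign.mono fun s hs => hs k hk) hsq
    exact ⟨_, ((HasPolyDerivAt.C_comp hd.hasDerivAt).mul hP).congr hpP⟩

/-- The derivative of orthonormal polynomials with respect to the deformation parameter. -/
theorem deformation_equation {L : ℝ → ℂ[X] →ₗ[ℂ] ℂ} {α μ t : ℝ} (ht : t ≠ 0)
    (hL : ∀ f, HasDerivAt (fun s => L s f)
      (((α + μ + 1) * L t f + L t (X * derivative f) - L t (X * f)) / t) t) {N : ℕ}
    {p : ℝ → ℕ → ℂ[X]} (hp : ∀ᶠ s in 𝓝 t, IsOrthonormalFor (L s) N (p s)) {k : ℕ}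
    (hk : k + 1 ≤ N) {q' : ℂ[X]} (hq : HasPolyDerivAt (fun s => p s k) q' t) :
    2 * q'.coeff k / gam (p t) k = 1 + theta α μ t (p t) k / t ∧
    C (t : ℂ) * q' = C ((k : ℂ) + (theta α μ t (p t) k + t) / 2) * p t k -
      X * derivative (p t k) + (X - C (bCoeff (p t) k)) * p t k -
        C (aCoeff (p t) (k + 1)) * p t (k + 1) := by
  have h := hp.self_of_nhds
  have ht0 : (t : ℂ) ≠ 0 := by exact_mod_cast ht
  have g1 := h.gam_ne_zero hk
  have g0 := h.gam_ne_zero (show k ≤ N by omega)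
  have hq0 : ∀ i, k < i → q'.coeff i = 0 := fun i hi =>
    (hq.2 i).unique ((hasDerivAt_const t (0 : ℂ)).congr_of_eventuallyEq
      (hp.mono fun s hs => hs.coeff_of_lt (by omega) hi))
  have hX : ∀ f : ℂ[X], (∀ i, k < i → f.coeff i = 0) → ∀ i, k + 1 < i → (X * f).coeff i = 0 := by
    intro f hf i hi
    obtain ⟨i, rfl⟩ : ∃ j, i = j + 1 := ⟨i - 1, by omega⟩
    rw [coeff_X_mul, hf i (by omega)]
  have hXd : ∀ f : ℂ[X], (∀ i, k < i → f.coeff i = 0) →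
      ∀ i, k < i → (X * derivative f).coeff i = 0 := by
    intro f hf i hi
    rw [coeff_X_mul_derivative, hf i hi, mul_zero]
  -- The two sides are two derivatives of L_s(p_k f) at t: by the product rule, and from its value
  -- f_k / γ_k(s).
  have key : ∀ f : ℂ[X], (∀ i, k < i → f.coeff i = 0) →
      ((α + μ + 1) * L t (p t k * f) + L t (X * derivative (p t k) * f) +
        L t (p t k * (X * derivative f)) - L t (p t k * (X * f))) / t + L t (q' * f) =
      -(f.coeff k * q'.coeff k / gam (p t) k ^ 2) := by
    intro f hf
    have h1 := (hq.mul (HasPolyDerivAt.const f t)).functional hL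
    have h2 : HasDerivAt (fun s => L s (p s k * f))
        (f.coeff k * (-q'.coeff k / (p t k).coeff k ^ 2)) t := by
      have h3 := ((hq.2 k).inv (by rwa [h.coeff_self (by omega)])).const_mul (f.coeff k)
      refine h3.congr_of_eventuallyEq (hp.mono fun s hs => ?_)
      simp only [Pi.inv_apply]
      rw [hs.functional_mul_of_natDegree_le (show k ≤ N by omega) f hf,
        hs.coeff_self (by omega), div_eq_mul_inv]
    have h4 := h1.unique h2
    have e1 : X * derivative (p t k * f) =
        X * derivative (p t k) * f + p t k * (X * derivative f) := by
      rw [derivative_mul]; ring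
    rw [e1, map_add, show X * (p t k * f) = p t k * (X * f) by ring, mul_zero, add_zero,
      h.coeff_self (by omega)] at h4
    rw [add_assoc ((α + μ + 1 : ℂ) * _), h4]
    ring
  have hpk : ∀ i, k < i → (p t k).coeff i = 0 := fun i hi => h.coeff_of_lt (by omega) hi
  have hθ : theta α μ t (p t) k = gam1 (p t) k / gam (p t) k -
      gam1 (p t) (k + 1) / gam (p t) (k + 1) - 2 * k - 1 - α - μ - t := by
    rw [theta, bCoeff]
  -- Taking f = p_k, where L(x p_k' p_k) = k and L(x p_k²) = b_k, leaves an equation for the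
  -- derivative of γ_k alone.
  have hγ : 2 * q'.coeff k / gam (p t) k = 1 + theta α μ t (p t) k / t := by
    have h1 := key (p t k) hpk
    rw [mul_comm (X * derivative (p t k)), mul_comm q', h.orthonormal k (by omega) k (by omega),
      if_pos rfl,
      h.functional_mul_of_natDegree_le (show k ≤ N by omega) _ (hXd _ hpk),
      h.functional_mul_of_natDegree_le_succ hk _ (hX _ hpk),
      h.functional_mul_of_natDegree_le (show k ≤ N by omega) q' hq0,
      coeff_X_mul_derivative, coeff_X_mul, h.coeff_X_mul_self (by omega),
      h.coeff_self (by omega)] at h1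
    rw [hθ]
    field_simp at h1 ⊢
    linear_combination h1
  refine ⟨hγ, ?_⟩
  have hq'k : q'.coeff k = gam (p t) k * (t + theta α μ t (p t) k) / (2 * t) := by
    field_simp at hγ ⊢
    linear_combination hγ
  have ha : aCoeff (p t) (k + 1) = gam (p t) k / gam (p t) (k + 1) := rfl
  have hb : bCoeff (p t) k = gam1 (p t) k / gam (p t) k -
      gam1 (p t) (k + 1) / gam (p t) (k + 1) := rfl
  set θ := theta α μ t (p t) k
  -- The last two terms of the claim stand for a_k p_{k-1}; in this form k = 0 is not exceptional.
  rw [← sub_eq_zero]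
  refine h.eq_zero_of_forall_functional_mul (show k ≤ N by omega) _ ?_ ?_
  · intro i hi
    obtain ⟨i, rfl⟩ : ∃ j, i = j + 1 := ⟨i - 1, by omega⟩
    simp only [sub_mul, coeff_sub, coeff_add, coeff_C_mul, coeff_X_mul_derivative]
    simp only [coeff_X_mul]
    rw [hq0 _ hi, hpk _ hi]
    rcases Nat.eq_or_lt_of_le (show k ≤ i by omega) with rfl | hi
    · rw [h.coeff_self hk, h.coeff_self (by omega), ha]
      field_simp; ring
    · rw [hpk _ hi, h.coeff_of_lt hk (by omega)]
      ring
  · intro f hf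
    have e : (C (t : ℂ) * q' - (C ((k : ℂ) + (θ + t) / 2) * p t k -
        X * derivative (p t k) + (X - C (bCoeff (p t) k)) * p t k -
          C (aCoeff (p t) (k + 1)) * p t (k + 1))) * f =
        (t : ℂ) • (q' * f) + X * derivative (p t k) * f -
          ((k : ℂ) + (θ + t) / 2 - bCoeff (p t) k) • (p t k * f) - p t k * (X * f) +
          aCoeff (p t) (k + 1) • (p t (k + 1) * f) := by
      simp only [smul_eq_C_mul, map_sub, map_add]; ring
    have h1 := key f hf
    rw [h.functional_mul_of_natDegree_le (show k ≤ N by omega) _ hf,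
      h.functional_mul_of_natDegree_le (show k ≤ N by omega) _ (hXd _ hf),
      h.functional_mul_of_natDegree_le_succ hk _ (hX _ hf), coeff_X_mul_derivative,
      coeff_X_mul, hq'k] at h1
    rw [e, map_add, map_sub, map_sub, map_add, map_smul, map_smul, map_smul,
      h.functional_mul_of_natDegree_le (show k ≤ N by omega) _ hf,
      h.functional_mul_of_natDegree_le hk _ fun i hi => hf i (by omega),
      h.functional_mul_of_natDegree_le_succ hk _ (hX _ hf),
      coeff_X_mul, hf (k + 1) (by omega), hb]
    rw [hθ] at h1 ⊢
    simp only [smul_eq_mul]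
    generalize L t (q' * f) = u at h1 ⊢
    generalize L t (X * derivative (p t k) * f) = v at h1 ⊢
    field_simp at h1 ⊢
    linear_combination h1

end OrthoPoly

/-! ### The two linear systems -/

namespace OrthoPoly

/-- The linear system in `x`. -/
theorem hasDerivAt_vec {L : ℂ[X] →ₗ[ℂ] ℂ} {p : ℕ → ℂ[X]} {α μ t : ℝ} {m : ℕ}
    (h : IsOrthonormalFor L (m + 2) p) (hP : IsPearson α μ t L) (ht : t ≠ 0) {x : ℂ}
    (hx : x ≠ 0) (hxt : x ≠ t) :
    HasDerivAt (fun z : ℂ => vec p (m + 1) z)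
      ((matAInf + x⁻¹ • matA0 α μ t p (m + 1) + (x - (t : ℂ))⁻¹ • matAt α μ t p (m + 1)) *ᵥ
        vec p (m + 1) x) x := by
  have ht0 : (t : ℂ) ≠ 0 := by exact_mod_cast ht
  have hxt' : x - t ≠ 0 := sub_ne_zero.2 hxt
  have h1 := congrArg (Polynomial.eval x) (h.ladder_upper hP le_rfl)
  have h2 := congrArg (Polynomial.eval x) (h.ladder_lower hP (Nat.le_succ _))
  simp only [eval_mul, eval_add, eval_sub, eval_X, eval_C] at h1 h2
  rw [hasDerivAt_pi]
  intro i
  fin_cases i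
  · refine ((p (m + 1)).hasDerivAt x).congr_deriv ?_
    simp [vec, matAInf, matA0, matAt, Matrix.mulVec, dotProduct, Fin.sum_univ_two]
    refine mul_left_cancel₀ (mul_ne_zero hx hxt') (h1.trans ?_)
    field_simp
    ring
  · refine ((p m).hasDerivAt x).congr_deriv ?_
    simp [vec, matAInf, matA0, matAt, Matrix.mulVec, dotProduct, Fin.sum_univ_two]
    refine mul_left_cancel₀ (mul_ne_zero hx hxt') (h2.trans ?_)
    field_simp
    ring

end OrthoPoly

theorem mainTheorem7
    (ζ α μ : ℝ) (hζ : ζ < 1) (hα : -1 < α) (hμ : -1 < μ) (ω : ℂ)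
    (t : ℝ) (ht : 0 < t) (n : ℕ) (hn : 1 ≤ n)
    -- `p s k` is the orthonormal polynomial of degree `k` for the weight with parameter `s`
    (p : ℝ → ℕ → ℂ[X])
    (hp : ∀ᶠ s in 𝓝 t, IsOrthonormalUpTo (n + 1) (deformedLaguerreWeight ζ α μ ω s) (p s))
    -- orthonormality fixes each polynomial up to a sign: the sign is not to jump near `t`
    (hsign : ∀ᶠ s in 𝓝 t, ∀ k ≤ n, 0 < (OrthoPoly.gam (p s) k / OrthoPoly.gam (p t) k).re) :
    -- the three term recurrence, with the coefficients that enter the matrices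
    (∀ k ≤ n, Polynomial.C (OrthoPoly.aCoeff (p t) (k + 1)) * p t (k + 1) =
      (Polynomial.X - Polynomial.C (OrthoPoly.bCoeff (p t) k)) * p t k -
        (if k = 0 then 0 else Polynomial.C (OrthoPoly.aCoeff (p t) k) * p t (k - 1))) ∧
    -- the linear system in `x`
    (∀ x : ℂ, x ≠ 0 → x ≠ (t : ℂ) →
      HasDerivAt (fun z : ℂ => OrthoPoly.vec (p t) n z)
        ((OrthoPoly.matAInf + x⁻¹ • OrthoPoly.matA0 α μ t (p t) n +
            (x - (t : ℂ))⁻¹ • OrthoPoly.matAt α μ t (p t) n) *ᵥ OrthoPoly.vec (p t) n x) x) ∧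
    -- the linear system in `t`
    (∀ x : ℂ, x ≠ (t : ℂ) →
      HasDerivAt (fun s : ℝ => OrthoPoly.vec (p s) n x)
        ((OrthoPoly.matB α μ t (p t) n -
            (x - (t : ℂ))⁻¹ • OrthoPoly.matAt α μ t (p t) n) *ᵥ OrthoPoly.vec (p t) n x) t) ∧
    -- the logarithmic derivatives of the leading coefficients, for `n` and for `n - 1`
    (DifferentiableAt ℝ (fun s : ℝ => OrthoPoly.gam (p s) n) t ∧
      2 * deriv (fun s : ℝ => OrthoPoly.gam (p s) n) t / OrthoPoly.gam (p t) n =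
        1 + OrthoPoly.theta α μ t (p t) n / (t : ℂ)) ∧
    (DifferentiableAt ℝ (fun s : ℝ => OrthoPoly.gam (p s) (n - 1)) t ∧
      2 * deriv (fun s : ℝ => OrthoPoly.gam (p s) (n - 1)) t / OrthoPoly.gam (p t) (n - 1) =
        1 + OrthoPoly.theta α μ t (p t) (n - 1) / (t : ℂ)) := by
  open OrthoPoly in
  obtain ⟨m, rfl⟩ : ∃ m, n = m + 1 := ⟨n - 1, by omega⟩
  have ht0 : (t : ℂ) ≠ 0 := by exact_mod_cast ht.ne'
  have ho : ∀ᶠ s in 𝓝 t, IsOrthonormalFor (laguerreFunctional ζ α μ ω s) (m + 2) (p s) := by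
    filter_upwards [hp, lt_mem_nhds ht] with s h1 h2
    exact IsOrthonormalUpTo.isOrthonormalFor hα hμ h2 h1
  have h := ho.self_of_nhds
  have hL := hasDerivAt_laguerreFunctional (ζ := ζ) (ω := ω) hα hμ ht
  have hP := isPearson_laguerreFunctional (ζ := ζ) (ω := ω) hα hμ ht
  have hgam : ∀ k ≤ m + 1, ∀ q', HasPolyDerivAt (fun s => p s k) q' t →
      HasDerivAt (fun s => gam (p s) k) (q'.coeff k) t := fun k hk q' hq =>
    (hq.2 k).congr_of_eventuallyEq (ho.mono fun s hs => (hs.coeff_self (by omega)).symm)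
  obtain ⟨q₁, hq₁⟩ := exists_hasPolyDerivAt hL ho (Nat.le_succ _) hsign (m + 1) le_rfl
  obtain ⟨q₀, hq₀⟩ := exists_hasPolyDerivAt hL ho (Nat.le_succ _) hsign m (Nat.le_succ _)
  obtain ⟨hγ₁, hd₁⟩ := deformation_equation ht.ne' hL ho le_rfl hq₁
  obtain ⟨hγ₀, hd₀⟩ := deformation_equation ht.ne' hL ho (Nat.le_succ _) hq₀
  refine ⟨fun k hk => h.three_term_recurrence (by omega),
    fun x hx hxt => hasDerivAt_vec h hP ht.ne' hx hxt, fun x hxt => ?_, ?_, ?_⟩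
  · have hxt' : x - t ≠ 0 := sub_ne_zero.2 hxt
    have hθ : theta α μ t (p t) m = bCoeff (p t) m - 2 * m - 1 - α - μ - t := rfl
    have hr := congrArg (Polynomial.eval x) (h.three_term_recurrence (k := m + 1) le_rfl)
    have e₁ := congrArg (Polynomial.eval x) hd₁
    have e₀ := congrArg (Polynomial.eval x) hd₀
    have u := congrArg (Polynomial.eval x) (h.ladder_upper hP le_rfl)
    have l := congrArg (Polynomial.eval x) (h.ladder_lower hP (Nat.le_succ _))
    rw [if_neg (Nat.succ_ne_zero m), Nat.add_sub_cancel] at hr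
    simp only [eval_mul, eval_add, eval_sub, eval_X, eval_C, Nat.cast_add, Nat.cast_one]
      at hr e₁ e₀ u l
    rw [hasDerivAt_pi]
    intro i
    fin_cases i
    · refine (hq₁.eval x).congr_deriv ?_
      simp [OrthoPoly.vec, matB, matAt, Matrix.mulVec, dotProduct, Fin.sum_univ_two]
      field_simp
      -- The recurrence `hr` turns the p_{m+2} term into a p_m term, and `u` removes x(x - t) p'.
      -- Nothing is divided by x, so x = 0 is allowed.
      linear_combination 2 * (x - t) * e₁ - 2 * u - 2 * (x - t) * hr
    · refine (hq₀.eval x).congr_deriv ?_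
      simp [OrthoPoly.vec, matB, matAt, Matrix.mulVec, dotProduct, Fin.sum_univ_two]
      rw [hθ] at e₀ l ⊢
      field_simp
      -- No recurrence is needed: p_{m+1} is itself a component of the vector.
      linear_combination 2 * (x - t) * e₀ - 2 * l
  · have hg := hgam (m + 1) le_rfl q₁ hq₁
    exact ⟨hg.differentiableAt, by rw [hg.deriv, hγ₁]⟩
  · have hg := hgam m (Nat.le_succ _) q₀ hq₀
    exact ⟨hg.differentiableAt, by rw [Nat.add_sub_cancel, hg.deriv, hγ₀]⟩
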